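/- Let $(y_{m,n})_{n\in\mathbb Z}$, $m\ge 1$, be mutually independent, stationary, zero-mean (circularly symmetric) complex Gaussian time series, with covariances $r_m(u)=\mathbb E[y_{m,n+u}\overline{y_{m,n}}]$ and spectral densities $s_m(\nu)=\sum_{u\in\mathbb Z}r_m(u)e^{-2i\pi u\nu}$. Assume $$\sup_{m\ge1}\sum_{u\in\mathbb Z}(1+|u|)\,|r_m(u)|<+\infty ,\qquad \inf_{m\ge1}\min_{\nu\in[0,1]}s_m(\nu)>0 .$$ Let $M=M(N)$ and $B=B(N)$ be integer sequences, $B$ even, such that for some $\rho\in(0,1)$ and $C_1,C_2\in(0,\infty)$ one has $C_1N^\rho\le B\le C_2N^\rho$ and $C_1N^\rho\le M\le C_2N^\rho$ for all large $N$, and $M/B\to c\in(0,\infty)$ as $N\to\infty$. For each $m$ let $(\epsilon_{m,n})_{n\in\mathbb Z}$ be the normalized innovation sequence of $(y_{m,n})_{n\in\mathbb Z}$: $\epsilon_{m,n}$ is the difference between $y_{m,n}$ and its orthogonal projection in $L^2$ on the closed complex linear span of $(y_{m,k})_{k<n}$, divided by its $L^2$ norm. Let $a_{m,k}=\mathbb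 E[y_{m,n}\overline{\epsilon_{m,n-k}}]$, $k\ge0$, be the coefficients of the causal representation $y_{m,n}=\sum_{k\ge0}a_{m,k}\epsilon_{m,n-k}$, and $h_m(\nu)=\sum_{k\ge0}a_{m,k}e^{-2i\pi k\nu}$. For a series $x$ put $\xi_x(\nu)=N^{-1/2}\sum_{n=1}^Nx_ne^{-2i\pi(n-1)\nu}$, and define $$\hat s_{ij}(\nu)=\frac1{B+1}\sum_{b=-B/2}^{B/2}\xi_{y_i}\overline{\xi_{y_j}}\Big(\nu+\frac bN\Big),\qquad \tilde s_{ij}(\nu)=\frac1{B+1}\sum_{b=-B/2}^{B/2}\big(h_i\overline{h_j}\,\xi_{\epsilon_i}\overline{\xi_{\epsilon_j}}\big)\Big(\nu+\frac bN\Big).$$ Let $\mathcal G=\{k\frac{B+1}N: k\in\mathbb N,\ 0\le k\le\frac N{B+1}\}$. Then $\sum_{k\ge 0}|a_{m,k}|<\infty$ for every $m$ (so that $h_m$ is given by an absolutely convergent series), and there exists $\delta>0$ such that, as $N\to\infty$, $$\sqrt{B+1}\,\max_{1\le i<j\le M}\ \max_{\nu\in\mathcal G}\big|\hat s_{ij}(\nu)-\tilde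 s_{ij}(\nu)\big|=\mathcal O_P(N^{-\delta}).$$ -/

import Mathlib

open MeasureTheory ProbabilityTheory Filter Topology
open scoped NNReal ENNReal

noncomputable section

namespace BartlettApprox

variable {Ω : Type*} [MeasurableSpace Ω]

/-! ### Complex Gaussian stationary time series -/

/-- `Z ∼ 𝒩_ℂ(0, v)`: real and imaginary parts are independent with law `𝒩(0, v / 2)`. -/
def IsComplexGaussian (P : Measure Ω) (Z : Ω → ℂ) (v : ℝ≥0) : Prop :=
  P.map (fun ω => (Z ω).re) = gaussianReal 0 (v / 2) ∧
  P.map (fun ω => (Z ω).im) = gaussianReal 0 (v / 2) ∧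
  IndepFun (fun ω => (Z ω).re) (fun ω => (Z ω).im) P

/-- A zero-mean (circularly symmetric) complex Gaussian process: every finite complex linear
combination of its values is zero-mean complex Gaussian. -/
def IsComplexGaussianProcess (P : Measure Ω) (x : ℤ → Ω → ℂ) : Prop :=
  ∀ c : ℤ →₀ ℂ, ∃ v : ℝ≥0,
    IsComplexGaussian P (fun ω => ∑ n ∈ c.support, c n * x n ω) v

/-- The covariance `r(u) = 𝔼[x_u conj(x_0)]` of a zero-mean stationary series. -/
def autocov (P : Measure Ω) (x : ℤ → Ω → ℂ) (u : ℤ) : ℂ :=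
  ∫ ω, x u ω * star (x 0 ω) ∂P

/-- Stationarity of a zero-mean series: `𝔼[x_{n+u} conj(x_n)]` does not depend on `n`. For zero-mean
circular complex Gaussian processes this is the same as invariance of the law under time shifts. -/
def IsStationary (P : Measure Ω) (x : ℤ → Ω → ℂ) : Prop :=
  ∀ n u : ℤ, ∫ ω, x (n + u) ω * star (x n ω) ∂P = autocov P x u

/-- The spectral density `s(ν) = ∑_u r(u) e^{-2iπuν}`; the sum is real, as `r(-u) = conj(r(u))`. -/
def spectralDensity (P : Measure Ω) (x : ℤ → Ω → ℂ) (ν : ℝ) : ℝ :=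
  (∑' u : ℤ, autocov P x u * Complex.exp (-2 * Real.pi * Complex.I * u * ν)).re

/-- Uniform short memory: `sup_m ∑_u (1 + |u|) |r_m(u)| < ∞`. -/
def UniformShortMemory (P : Measure Ω) (y : ℕ → ℤ → Ω → ℂ) : Prop :=
  ∃ C : ℝ, ∀ m : ℕ,
    Summable (fun u : ℤ => (1 + |(u : ℝ)|) * ‖autocov P (y m) u‖) ∧
    ∑' u : ℤ, (1 + |(u : ℝ)|) * ‖autocov P (y m) u‖ ≤ C

/-- The spectral densities are uniformly bounded away from zero. -/
def NonVanishingSpectrum (P : Measure Ω) (y : ℕ → ℤ → Ω → ℂ) : Prop :=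
  ∃ smin : ℝ, 0 < smin ∧ ∀ m : ℕ, ∀ ν ∈ Set.Icc (0 : ℝ) 1, smin ≤ spectralDensity P (y m) ν

/-! ### Innovations and the causal linear representation -/

open Classical in
/-- The class in `L²(P)` of a square-integrable random variable (and `0` for any other function). -/
def toL2 (P : Measure Ω) (X : Ω → ℂ) : Lp ℂ 2 P :=
  if h : MemLp X 2 P then h.toLp X else 0

/-- The past of the series before time `n`: the closed linear span in `L²(P)` of `x_k`, `k < n`. -/
def past (P : Measure Ω) (x : ℤ → Ω → ℂ) (n : ℤ) : Submodule ℂ (Lp ℂ 2 P) :=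
  (Submodule.span ℂ ((fun k : ℤ => toL2 P (x k)) '' Set.Iio n)).topologicalClosure

instance (P : Measure Ω) (x : ℤ → Ω → ℂ) (n : ℤ) : CompleteSpace (past P x n) := by
  unfold past; infer_instance

/-- The one-step linear prediction error of `x_n` given the past. -/
def predictionError (P : Measure Ω) (x : ℤ → Ω → ℂ) (n : ℤ) : Lp ℂ 2 P :=
  toL2 P (x n) - (past P x n).starProjection (toL2 P (x n))

/-- The normalized innovation `ε_n`. -/
def innovation (P : Measure Ω) (x : ℤ → Ω → ℂ) (n : ℤ) : Lp ℂ 2 P :=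
  ((‖predictionError P x n‖⁻¹ : ℝ) : ℂ) • predictionError P x n

/-- The coefficients `a_k = 𝔼[x_0 conj(ε_{-k})]` of the causal representation
`x_n = ∑_{k ≥ 0} a_k ε_{n-k}`. -/
def causalCoeff (P : Measure Ω) (x : ℤ → Ω → ℂ) (k : ℕ) : ℂ :=
  inner ℂ (innovation P x (-(k : ℤ))) (toL2 P (x 0))

/-- The transfer function `h(ν) = ∑_{k ≥ 0} a_k e^{-2iπkν}`. -/
def transfer (P : Measure Ω) (x : ℤ → Ω → ℂ) (ν : ℝ) : ℂ :=
  ∑' k : ℕ, causalCoeff P x k * Complex.exp (-2 * Real.pi * Complex.I * k * ν)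

/-! ### Periodograms -/

/-- The normalized Fourier transform `ξ_x(ν) = N^{-1/2} ∑_{n=1}^N x_n e^{-2iπ(n-1)ν}`. -/
def dft (N : ℕ) (x : ℤ → Ω → ℂ) (ν : ℝ) (ω : Ω) : ℂ :=
  (1 / (Real.sqrt N : ℂ)) * ∑ n ∈ Finset.Icc 1 N,
    x (n : ℤ) ω * Complex.exp (-2 * Real.pi * Complex.I * ((n : ℂ) - 1) * ν)

/-- The smoothed cross-periodogram `ŝ` of two series (`B` even). -/
def sHat (N B : ℕ) (x z : ℤ → Ω → ℂ) (ν : ℝ) (ω : Ω) : ℂ :=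
  (1 / ((B : ℂ) + 1)) * ∑ b ∈ Finset.Icc (-((B : ℤ) / 2)) ((B : ℤ) / 2),
    dft N x (ν + b / N) ω * star (dft N z (ν + b / N) ω)

/-- The approximation `s̃` built on the innovations of two series (`B` even). -/
def sTilde (P : Measure Ω) (N B : ℕ) (x z : ℤ → Ω → ℂ) (ν : ℝ) (ω : Ω) : ℂ :=
  (1 / ((B : ℂ) + 1)) * ∑ b ∈ Finset.Icc (-((B : ℤ) / 2)) ((B : ℤ) / 2),
    transfer P x (ν + b / N) * star (transfer P z (ν + b / N)) *
      dft N (fun n => ⇑(innovation P x n)) (ν + b / N) ω *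
      star (dft N (fun n => ⇑(innovation P z n)) (ν + b / N) ω)

/-- The frequencies `k (B + 1) / N`, with `k` a natural number at most `N / (B + 1)`. -/
def freqGrid (N B : ℕ) : Finset ℝ :=
  (Finset.range (N / (B + 1) + 1)).image (fun k : ℕ => (k : ℝ) * ((B : ℝ) + 1) / N)

/-- The triples `(i, j, ν)` with `i < j` among the first `M` series and `ν` in the grid. -/
def indexSet (N M B : ℕ) : Finset (ℕ × ℕ × ℝ) :=
  (Finset.range M ×ˢ Finset.range M ×ˢ freqGrid N B).filter (fun p => p.1 < p.2.1)

/-- `max |ŝ_ij(ν) - s̃_ij(ν)|` over the index set (`0` when there are fewer than two series). -/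
def maxDeviation (P : Measure Ω) (y : ℕ → ℤ → Ω → ℂ) (N M B : ℕ) (ω : Ω) : ℝ :=
  ((indexSet N M B).sup fun p =>
    ‖sHat N B (y p.1) (y p.2.1) p.2.2 ω - sTilde P N B (y p.1) (y p.2.1) p.2.2 ω‖₊ : ℝ≥0)

/-- `X_N = O_P(r_N)` as `N → ∞`. -/
def IsBigOInProb (P : Measure Ω) (X : ℕ → Ω → ℝ) (r : ℕ → ℝ) : Prop :=
  ∀ η : ℝ, 0 < η → ∃ K : ℝ, 0 < K ∧
    ∀ᶠ N in atTop, P {ω | K * r N < |X N ω|} ≤ ENNReal.ofReal η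

end BartlettApprox

end

/-! The estimate is made term by term, without using any cancellation in the average over `b`.
Suppose that `∑ (1 + k)|a_k| ≤ K` for every series. Then `ξ_y - h ξ_ε` is `N^{-1/2} ∑ a_k e^{-2iπkν}
D_k`, where `D_k` is the difference between a sum of `N` modulated innovations and the same sum
shifted by `k`. Only boundary terms survive in `D_k`, so its `L²` norm is at most `2k`, and the
error is at most `2K/√N` in `L²`, while `ξ_y` and `h ξ_ε` remain bounded (`norm_vectorDft_sub_le`).

All these variables lie in the closed span of a Gaussian process, where every `L^q` norm is
controlled by the `L²` norm (`IsComplexGaussianProcess.eLpNorm_le`). Markov's inequality with `q`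
large, and a union bound over `O(N³)` pairs (series, frequency), show that with high probability
none of them exceeds its size by more than a factor of order `N^ε`. Then `|ŝ - s̃|` is at most `2
N^{2ε - 1/2}`, and `√(B + 1) = O(N^{ρ/2})` with `ρ < 1` leaves a negative power of `N`.

It remains to find `K` uniform in `m`. This is a quantitative spectral factorization
(`exists_spectralFactor`). The density `S` has `S'` in the Wiener algebra, and `1/S` is continuously
differentiable, hence in that algebra too; so `(log S)' = S'/S` belongs to it. Let `g` be the part
of `log S` at frequencies `≤ 0`, with half of the mean. Then `H = e^g` satisfies `|H|² = S`, both
`H` and `1/H` have frequencies `≤ 0` only, and `H' = g'H` is in the Wiener algebra with explicit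
bounds. Under the isometry sending the value at time `u` to `e^{2iπu·}` in `L²(S dν)`, frequencies
`≤ 0` correspond to the past: `e^{2iπn·}/H` is the innovation at time `n` (`exists_innovation`), and
the causal coefficients are the Fourier coefficients of `H`. -/

namespace BartlettApprox

open AddCircle

/-! ### Absolutely convergent Fourier series -/

/-- The `n`-th Fourier coefficient as a continuous linear functional. -/
noncomputable def coeffCLM (n : ℤ) : C(UnitAddCircle, ℂ) →L[ℂ] ℂ :=
  LinearMap.mkContinuous
    { toFun := fun f => fourierCoeff f n
      map_add' := fun f g => by
        have hf : Integrable f (haarAddCircle (T := (1 : ℝ))) :=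
          f.continuous.integrable_of_hasCompactSupport (HasCompactSupport.of_compactSpace f)
        have hg : Integrable g (haarAddCircle (T := (1 : ℝ))) :=
          g.continuous.integrable_of_hasCompactSupport (HasCompactSupport.of_compactSpace g)
        have := congrFun (fourierCoeff.add hf hg) n
        simpa using this
      map_smul' := fun c f => by
        have := fourierCoeff.const_smul (T := (1 : ℝ)) f c n
        simpa using this } 1 (fun f => by
    have h : ‖∫ t : UnitAddCircle, fourier (-n) t • f t ∂haarAddCircle‖ ≤
        ‖f‖ * (haarAddCircle (T := (1 : ℝ))).real Set.univ :=
      norm_integral_le_of_norm_le_const (Eventually.of_forall fun t => by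
        rw [norm_smul]
        have h1 : ‖(fourier (-n) t : ℂ)‖ = 1 := Circle.norm_coe _
        rw [h1, one_mul]
        exact f.norm_coe_le_norm t)
    simpa [fourierCoeff] using h)

theorem coeffCLM_apply (n : ℤ) (f : C(UnitAddCircle, ℂ)) : coeffCLM n f = fourierCoeff f n := rfl

theorem norm_coeffCLM_le (n : ℤ) (f : C(UnitAddCircle, ℂ)) : ‖coeffCLM n f‖ ≤ ‖f‖ := by
  have := (coeffCLM n).le_of_opNorm_le (LinearMap.mkContinuous_norm_le _ zero_le_one _) f
  simpa using this

theorem fourier_mul_fourier (m n : ℤ) :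
    (fourier m * fourier n : C(UnitAddCircle, ℂ)) = fourier (m + n) := by
  ext x; simp

theorem star_fourier (m : ℤ) : star (fourier m : C(UnitAddCircle, ℂ)) = fourier (-m) := by
  ext x; simp

theorem coeffCLM_fourier_mul (k n : ℤ) (f : C(UnitAddCircle, ℂ)) :
    coeffCLM n (fourier k * f) = coeffCLM (n - k) f := by
  simp only [coeffCLM_apply, fourierCoeff]
  congr 1
  ext t
  have : (fourier (-(n - k)) t : ℂ) = fourier (-n) t * fourier k t := by
    rw [← fourier_add]; congr 1; ring_nf
  simp only [this, ContinuousMap.mul_apply, smul_eq_mul, mul_assoc]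

theorem coeffCLM_fourier (k n : ℤ) :
    coeffCLM n (fourier k : C(UnitAddCircle, ℂ)) = if n = k then 1 else 0 := by
  have := congrFun (fourierCoeff_fourier (T := (1 : ℝ)) k) n
  rw [coeffCLM_apply, this, Pi.single_apply]

theorem coeffCLM_star (n : ℤ) (f : C(UnitAddCircle, ℂ)) :
    coeffCLM n (star f) = star (coeffCLM (-n) f) := by
  simp only [coeffCLM_apply, fourierCoeff]
  have := integral_conj (μ := haarAddCircle (T := (1 : ℝ))) (f := fun t => fourier (-(-n)) t • f t)
  rw [Complex.star_def, ← this]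
  congr 1
  ext t
  simp

/-- The sum of the moduli of the Fourier coefficients. -/
noncomputable def wnorm (f : C(UnitAddCircle, ℂ)) : ℝ := ∑' n, ‖coeffCLM n f‖

theorem wnorm_nonneg (f : C(UnitAddCircle, ℂ)) : 0 ≤ wnorm f := tsum_nonneg fun _ => norm_nonneg _

theorem hasSum_fourier {f : C(UnitAddCircle, ℂ)} (hf : Summable fun n => ‖coeffCLM n f‖) :
    HasSum (fun n => coeffCLM n f • (fourier n : C(UnitAddCircle, ℂ))) f :=
  hasSum_fourier_series_of_summable hf.of_norm

/-- Fourier coefficients turn products into convolutions. -/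
theorem hasSum_coeffCLM_mul {f : C(UnitAddCircle, ℂ)} (hf : Summable fun n => ‖coeffCLM n f‖)
    (g : C(UnitAddCircle, ℂ)) (n : ℤ) :
    HasSum (fun j => coeffCLM j f * coeffCLM (n - j) g) (coeffCLM n (f * g)) := by
  have h := (hasSum_fourier hf).mul_right g
  have h2 := (coeffCLM n).hasSum h
  simpa only [smul_mul_assoc, map_smul, coeffCLM_fourier_mul, smul_eq_mul] using h2

theorem summable_coeffCLM_mul {f g : C(UnitAddCircle, ℂ)}
    (hf : Summable fun n => ‖coeffCLM n f‖) (hg : Summable fun n => ‖coeffCLM n g‖) :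
    (Summable fun n => ‖coeffCLM n (f * g)‖) ∧ wnorm (f * g) ≤ wnorm f * wnorm g := by
  have hp : Summable fun p : ℤ × ℤ => ‖coeffCLM p.1 f‖ * ‖coeffCLM p.2 g‖ :=
    hf.mul_of_nonneg hg (fun _ => norm_nonneg _) (fun _ => norm_nonneg _)
  -- The shear `(n, j) ↦ (j, n - j)` regroups the double series of products into convolutions.
  let e : ℤ × ℤ ≃ ℤ × ℤ :=
    { toFun := fun p => (p.2, p.1 - p.2)
      invFun := fun q => (q.1 + q.2, q.1)
      left_inv := fun p => by simp
      right_inv := fun q => by simp }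
  have hpe : Summable fun p : ℤ × ℤ => ‖coeffCLM p.2 f‖ * ‖coeffCLM (p.1 - p.2) g‖ :=
    (e.summable_iff (f := fun p : ℤ × ℤ => ‖coeffCLM p.1 f‖ * ‖coeffCLM p.2 g‖)).2 hp
  have hle : ∀ n, ‖coeffCLM n (f * g)‖ ≤ ∑' j, ‖coeffCLM j f‖ * ‖coeffCLM (n - j) g‖ := fun n => by
    rw [← (hasSum_coeffCLM_mul hf g n).tsum_eq]
    refine (norm_tsum_le_tsum_norm ?_).trans_eq ?_
    · simpa using hpe.prod_factor n
    · simp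
  have hs : Summable fun n => ‖coeffCLM n (f * g)‖ :=
    Summable.of_nonneg_of_le (fun _ => norm_nonneg _) hle hpe.prod
  refine ⟨hs, (hs.tsum_le_tsum hle hpe.prod).trans_eq ?_⟩
  rw [wnorm, wnorm, hf.tsum_mul_tsum hg hp, ← e.tsum_eq, ← hpe.tsum_prod]
  rfl

/-- Parseval's identity for continuous functions. -/
theorem hasSum_sq_coeffCLM (f : C(UnitAddCircle, ℂ)) :
    HasSum (fun n => ‖coeffCLM n f‖ ^ 2) (∫ t, ‖f t‖ ^ 2 ∂(haarAddCircle (T := (1 : ℝ)))) := by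
  have h := hasSum_sq_fourierCoeff
    (ContinuousMap.toLp (E := ℂ) 2 (haarAddCircle (T := (1 : ℝ))) ℂ f)
  simp only [fourierCoeff_toLp] at h
  have h2 : ∫ t, ‖f t‖ ^ 2 ∂(haarAddCircle (T := (1 : ℝ))) = ∫ t, ‖ContinuousMap.toLp (E := ℂ) 2
      (haarAddCircle (T := (1 : ℝ))) ℂ f t‖ ^ 2 ∂(haarAddCircle (T := (1 : ℝ))) := ?_
  · rw [h2]; exact h
  refine integral_congr_ae ?_
  filter_upwards [ContinuousMap.coeFn_toLp (p := 2) (𝕜 := ℂ) (haarAddCircle (T := (1 : ℝ))) f]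
    with t ht
  rw [ht]

theorem tsum_sq_coeffCLM_le (f : C(UnitAddCircle, ℂ)) :
    (Summable fun n => ‖coeffCLM n f‖ ^ 2) ∧ ∑' n, ‖coeffCLM n f‖ ^ 2 ≤ ‖f‖ ^ 2 := by
  have h := hasSum_sq_coeffCLM f
  refine ⟨h.summable, h.tsum_eq.trans_le ?_⟩
  have h2 : ‖∫ t, ‖f t‖ ^ 2 ∂(haarAddCircle (T := (1 : ℝ)))‖ ≤
      ‖f‖ ^ 2 * (haarAddCircle (T := (1 : ℝ))).real Set.univ :=
    norm_integral_le_of_norm_le_const (Eventually.of_forall fun t => by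
      rw [Real.norm_of_nonneg (by positivity)]
      gcongr; exact f.norm_coe_le_norm t)
  simpa using (le_abs_self _).trans h2

/-- `f'` is the derivative of `f`. -/
def HasDerivCircle (f f' : C(UnitAddCircle, ℂ)) : Prop :=
  ∀ x : ℝ, HasDerivAt (fun t : ℝ => f (t : UnitAddCircle)) (f' (x : UnitAddCircle)) x

/-- Integration by parts over one period; the boundary terms cancel because `0` and `1` are the same
point of the circle. -/
theorem HasDerivCircle.coeffCLM_eq {f f' : C(UnitAddCircle, ℂ)} (h : HasDerivCircle f f') (n : ℤ) :
    coeffCLM n f' = 2 * Real.pi * Complex.I * n * coeffCLM n f := by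
  simp only [coeffCLM_apply, fourierCoeff_eq_intervalIntegral _ _ 0]
  have hd : ∀ x : ℝ, HasDerivAt (fun t : ℝ => (fourier (-n) (t : UnitAddCircle) : ℂ) * f t)
      (-2 * Real.pi * Complex.I * n / (1 : ℝ) * fourier (-n) (x : UnitAddCircle) * f x +
        fourier (-n) (x : UnitAddCircle) * f' x) x := fun x =>
    (hasDerivAt_fourier_neg 1 n x).mul (h x)
  have hc : Continuous fun x : ℝ => fourier (-n) (x : UnitAddCircle) * f x := by
    have := AddCircle.continuous_mk' (1 : ℝ)
    fun_prop
  have hc' : Continuous fun x : ℝ => fourier (-n) (x : UnitAddCircle) * f' x := by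
    have := AddCircle.continuous_mk' (1 : ℝ)
    fun_prop
  have hi := intervalIntegral.integral_eq_sub_of_hasDerivAt (a := 0) (b := 1) (fun x _ => hd x)
    (by
      apply Continuous.intervalIntegrable
      simp only [mul_assoc]
      fun_prop)
  have h1 : ((1 : ℝ) : UnitAddCircle) = ((0 : ℝ) : UnitAddCircle) := by
    simp
  simp only [h1, sub_self, mul_assoc] at hi
  rw [intervalIntegral.integral_add (Continuous.intervalIntegrable (by fun_prop) _ _)
    (Continuous.intervalIntegrable (by fun_prop) _ _)] at hi
  simp only [mul_assoc, Complex.ofReal_one, div_one, intervalIntegral.integral_const_mul] at hi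
  simp only [div_one, one_smul, zero_add, smul_eq_mul]
  simp only [mul_assoc]
  linear_combination hi

/-- A bound for `wnorm` of a continuously differentiable function. -/
theorem HasDerivCircle.summable {f f' : C(UnitAddCircle, ℂ)} (h : HasDerivCircle f f') :
    (Summable fun n => ‖coeffCLM n f‖) ∧
      wnorm f ≤ ‖f‖ + (‖f'‖ ^ 2 + ∑' n : ℤ, 1 / (n : ℝ) ^ 2) := by
  have hz : Summable fun n : ℤ => 1 / (n : ℝ) ^ 2 := Real.summable_one_div_int_pow.2 one_lt_two
  obtain ⟨hs, hb⟩ := tsum_sq_coeffCLM_le f'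
  -- For `n ≠ 0` this is `2ab ≤ a² + b²` with `b = 1/|n|` and `a = 2|n||c_n|`, which is at most the
  -- modulus of the coefficient of `f'`. At `n = 0` the convention `1 / 0 = 0` removes the last term
  -- and `‖f‖` is used instead.
  have hle : ∀ n, ‖coeffCLM n f‖ ≤
      Pi.single (M := fun _ => ℝ) (0 : ℤ) ‖f‖ n + (‖coeffCLM n f'‖ ^ 2 + 1 / (n : ℝ) ^ 2) := fun n => by
    rcases eq_or_ne n 0 with rfl | hn
    · have := norm_coeffCLM_le 0 f
      simp only [Pi.single_eq_same]
      have : 0 ≤ ‖coeffCLM 0 f'‖ ^ 2 + 1 / ((0 : ℤ) : ℝ) ^ 2 := by positivity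
      linarith
    · have hn' : (0 : ℝ) < |(n : ℝ)| := by positivity
      rw [Pi.single_eq_of_ne hn, h.coeffCLM_eq n, zero_add]
      simp only [norm_mul, Complex.norm_I, Complex.norm_real, Complex.norm_intCast, Real.norm_eq_abs,
        abs_of_pos Real.pi_pos, Complex.norm_ofNat, mul_one]
      rw [← sq_abs (n : ℝ)]
      have h1 : ‖coeffCLM n f‖ ≤ (2 * |(n:ℝ)| * ‖coeffCLM n f‖) * (1 / |(n : ℝ)|) := by
        field_simp; linarith [norm_nonneg (coeffCLM n f)]
      have h2 : |(n:ℝ)| * ‖coeffCLM n f‖ ≤ Real.pi * |(n:ℝ)| * ‖coeffCLM n f‖ := by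
        have : 0 ≤ |(n:ℝ)| * ‖coeffCLM n f‖ := by positivity
        nlinarith [Real.pi_gt_three]
      have h3 : (2 * |(n:ℝ)| * ‖coeffCLM n f‖) ^ 2 ≤ (2 * Real.pi * |(n:ℝ)| * ‖coeffCLM n f‖) ^ 2 := by
        apply pow_le_pow_left₀ (by positivity); linarith
      have h4 := two_mul_le_add_sq (2 * |(n:ℝ)| * ‖coeffCLM n f‖) (1 / |(n : ℝ)|)
      have h5 : (1 / |(n : ℝ)|) ^ 2 = 1 / |(n : ℝ)| ^ 2 := by ring
      have h6 : 0 ≤ (2 * |(n:ℝ)| * ‖coeffCLM n f‖) * (1 / |(n : ℝ)|) := by positivity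
      linarith
  have hsum := ((hasSum_pi_single (0 : ℤ) ‖f‖).summable).add (hs.add hz)
  have hs' : Summable fun n => ‖coeffCLM n f‖ :=
    Summable.of_nonneg_of_le (fun _ => norm_nonneg _) hle hsum
  refine ⟨hs', (hs'.tsum_le_tsum hle hsum).trans ?_⟩
  rw [((hasSum_pi_single (0 : ℤ) ‖f‖).summable).tsum_add (hs.add hz),
    hs.tsum_add hz]
  have : ∑' n, Pi.single (M := fun _ => ℝ) (0 : ℤ) ‖f‖ n = ‖f‖ := tsum_pi_single _ _
  linarith

/-- The sum of the trigonometric series with coefficients `c`. -/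
noncomputable def trigSeries (c : ℤ → ℂ) : C(UnitAddCircle, ℂ) := ∑' n, c n • fourier n

theorem norm_smul_fourier (c : ℂ) (n : ℤ) : ‖c • (fourier n : C(UnitAddCircle, ℂ))‖ = ‖c‖ := by
  rw [norm_smul, fourier_norm, mul_one]

theorem hasSum_trigSeries {c : ℤ → ℂ} (hc : Summable fun n => ‖c n‖) :
    HasSum (fun n => c n • (fourier n : C(UnitAddCircle, ℂ))) (trigSeries c) :=
  (Summable.of_norm (by simpa only [norm_smul_fourier] using hc)).hasSum

theorem hasSum_trigSeries_apply {c : ℤ → ℂ} (hc : Summable fun n => ‖c n‖) (x : UnitAddCircle) :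
    HasSum (fun n => c n * fourier n x) (trigSeries c x) := by
  exact (ContinuousMap.evalCLM ℂ x).hasSum (hasSum_trigSeries hc)

theorem coeffCLM_trigSeries {c : ℤ → ℂ} (hc : Summable fun n => ‖c n‖) (n : ℤ) :
    coeffCLM n (trigSeries c) = c n := by
  have h := (coeffCLM n).hasSum (hasSum_trigSeries hc)
  simp only [map_smul, coeffCLM_fourier, smul_eq_mul, mul_ite, mul_one, mul_zero] at h
  refine h.unique ?_
  convert hasSum_ite_eq n (c n) using 2 with k
  grind

theorem norm_trigSeries_le {c : ℤ → ℂ} (hc : Summable fun n => ‖c n‖) :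
    ‖trigSeries c‖ ≤ ∑' n, ‖c n‖ := by
  refine (norm_tsum_le_tsum_norm (by simpa only [norm_smul_fourier] using hc)).trans_eq ?_
  simp only [norm_smul_fourier]

theorem hasDerivCircle_trigSeries {c : ℤ → ℂ} (hc : Summable fun n => ‖c n‖)
    (hc' : Summable fun n : ℤ => ‖2 * Real.pi * Complex.I * n * c n‖) :
    HasDerivCircle (trigSeries c) (trigSeries fun n => 2 * Real.pi * Complex.I * n * c n) := by
  intro x
  have h := hasDerivAt_tsum (𝕜 := ℝ) (g := fun n (t : ℝ) => c n * fourier n (t : UnitAddCircle))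
    (g' := fun n t => 2 * Real.pi * Complex.I * n * c n * fourier n (t : UnitAddCircle)) hc'
    (fun n t => by
      have := (hasDerivAt_fourier 1 n t).const_mul (c n)
      refine this.congr_deriv ?_
      push_cast; ring)
    (fun n t => by
      rw [norm_mul]
      exact mul_le_of_le_one_right (norm_nonneg _)
        (((fourier n).norm_coe_le_norm (t : UnitAddCircle)).trans_eq (fourier_norm n)))
    (y₀ := 0) (hasSum_trigSeries_apply hc _).summable x
  simp only [(hasSum_trigSeries_apply hc _).tsum_eq, (hasSum_trigSeries_apply hc' _).tsum_eq] at h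
  exact h

end BartlettApprox

namespace BartlettApprox

open AddCircle

/-! ### Spectral factorization -/

theorem hasSum_exp (f : C(UnitAddCircle, ℂ)) :
    HasSum (fun k : ℕ => ((k.factorial : ℂ)⁻¹) • f ^ k) (NormedSpace.exp f) :=
  NormedSpace.exp_series_hasSum_exp' (𝕂 := ℂ) f

theorem exp_apply (f : C(UnitAddCircle, ℂ)) (x : UnitAddCircle) :
    NormedSpace.exp f x = Complex.exp (f x) := by
  have h := (ContinuousMap.evalCLM ℂ x).hasSum (hasSum_exp f)
  rw [Complex.exp_eq_exp_ℂ]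
  exact h.unique (NormedSpace.exp_series_hasSum_exp' (𝕂 := ℂ) (f x))

/-- The Fourier series of the exponential of a series with frequencies `n ≤ 0` is of this kind. -/
theorem coeffCLM_exp_eq_zero {f : C(UnitAddCircle, ℂ)} (hf : Summable fun n => ‖coeffCLM n f‖)
    (hf0 : ∀ n, 0 < n → coeffCLM n f = 0) {n : ℤ} (hn : 0 < n) :
    coeffCLM n (NormedSpace.exp f) = 0 := by
  -- In the convolution at a frequency `n > 0`, one of `j` and `n - j` is always positive.
  have hpow : ∀ (k : ℕ) (n : ℤ), 0 < n → coeffCLM n (f ^ k) = 0 := by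
    intro k
    induction k with
    | zero =>
      intro n hn
      have : (1 : C(UnitAddCircle, ℂ)) = fourier 0 := by ext x; simp
      rw [pow_zero, this, coeffCLM_fourier, if_neg hn.ne']
    | succ k ih =>
      intro n hn
      have h := hasSum_coeffCLM_mul hf (f ^ k) n
      rw [pow_succ', ← h.tsum_eq]
      refine (tsum_congr fun j => ?_).trans tsum_zero
      rcases lt_or_ge 0 j with hj | hj
      · rw [hf0 j hj, zero_mul]
      · rw [ih (n - j) (by omega), mul_zero]
  have h := (coeffCLM n).hasSum (hasSum_exp f)
  simp only [map_smul, hpow _ n hn, smul_zero] at h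
  exact h.unique hasSum_zero

theorem HasDerivCircle.exp {f f' : C(UnitAddCircle, ℂ)} (h : HasDerivCircle f f') :
    HasDerivCircle (NormedSpace.exp f) (f' * NormedSpace.exp f) := by
  intro x
  have := (h x).cexp
  simp only [exp_apply, ContinuousMap.mul_apply]
  exact this.congr_deriv (mul_comm _ _)

theorem HasDerivCircle.neg {f f' : C(UnitAddCircle, ℂ)} (h : HasDerivCircle f f') :
    HasDerivCircle (-f) (-f') := fun x => (h x).neg

/-- The data of a factorization `S = |H|²` with `H` outer, `G = 1 / H`. -/
structure IsSpectralFactor (S H G : C(UnitAddCircle, ℂ)) : Prop where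
  mul_eq_one : H * G = 1
  mul_star_eq : H * star H = S
  coeff_eq_zero : ∀ n, 0 < n → coeffCLM n H = 0
  coeff_inv_eq_zero : ∀ n, 0 < n → coeffCLM n G = 0
  summable_inv : Summable fun n => ‖coeffCLM n G‖
  summable : Summable fun n : ℤ => (1 + |(n : ℝ)|) * ‖coeffCLM n H‖

theorem norm_two_pi_I_mul (n : ℤ) (z : ℂ) :
    ‖2 * Real.pi * Complex.I * n * z‖ = 2 * Real.pi * (|(n : ℝ)| * ‖z‖) := by
  simp only [norm_mul, Complex.norm_I, Complex.norm_real, Complex.norm_intCast, Real.norm_eq_abs,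
        abs_of_pos Real.pi_pos, Complex.norm_ofNat, mul_one]
  ring

/-- The logarithm of a smooth positive function, with its derivative in the Wiener algebra. -/
theorem exists_log_bound (C smin : ℝ) (hs : 0 < smin) : ∃ K : ℝ, ∀ S S' : C(UnitAddCircle, ℂ),
    HasDerivCircle S S' → ‖S‖ ≤ C → (Summable fun n => ‖coeffCLM n S'‖) → ‖S'‖ ≤ C → wnorm S' ≤ C →
    (∀ x, (S x).im = 0) → (∀ x, smin ≤ (S x).re) →
    ∃ L L' : C(UnitAddCircle, ℂ), HasDerivCircle L L' ∧ (Summable fun n => ‖coeffCLM n L'‖) ∧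
      wnorm L' ≤ K ∧ ∀ x, L x = (Real.log (S x).re : ℝ) := by
  refine ⟨C * (smin⁻¹ + ((C * smin⁻¹ * smin⁻¹) ^ 2 + ∑' n : ℤ, 1 / (n : ℝ) ^ 2)), ?_⟩
  intro S S' hS hSC hS's hS'C hS'W him hre
  have hC : 0 ≤ C := (norm_nonneg _).trans hSC
  have hval : ∀ x, S x = ((S x).re : ℂ) := fun x => Complex.ext (by simp) (by simp [him x])
  have hne : ∀ x, S x ≠ 0 := fun x h => by
    have := hre x; rw [h] at this; simp at this; linarith
  have hslit : ∀ x, S x ∈ Complex.slitPlane := fun x => Or.inl (hs.trans_le (hre x))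
  let I : C(UnitAddCircle, ℂ) := ⟨fun x => (S x)⁻¹, S.continuous.inv₀ hne⟩
  let L : C(UnitAddCircle, ℂ) := ⟨fun x => Complex.log (S x), S.continuous.clog hslit⟩
  have hI : HasDerivCircle I (-(S' * I * I)) := fun x => by
    refine ((hS x).fun_inv (hne _)).congr_deriv ?_
    simp only [ContinuousMap.neg_apply, ContinuousMap.mul_apply, I, ContinuousMap.coe_mk]
    field_simp
  have hL : HasDerivCircle L (S' * I) := fun x => (hS x).clog_real (hslit _)
  have hInorm : ‖I‖ ≤ smin⁻¹ := by
    refine (ContinuousMap.norm_le _ (by positivity)).2 fun x => ?_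
    simp only [I, ContinuousMap.coe_mk, norm_inv]
    gcongr
    exact (hre x).trans (Complex.re_le_norm _)
  have hI'norm : ‖-(S' * I * I)‖ ≤ C * smin⁻¹ * smin⁻¹ := by
    rw [norm_neg]
    refine (norm_mul_le _ _).trans ?_
    gcongr
    refine (norm_mul_le _ _).trans ?_
    gcongr
  obtain ⟨hIs, hIw⟩ := hI.summable
  obtain ⟨hL's, hL'w⟩ := summable_coeffCLM_mul hS's hIs
  refine ⟨L, S' * I, hL, hL's, hL'w.trans ?_, fun x => ?_⟩
  · have := wnorm_nonneg I
    gcongr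
    refine hIw.trans ?_
    gcongr
  · simp only [L, ContinuousMap.coe_mk]
    rw [hval x, ← Complex.ofReal_log (hs.le.trans (hre x))]
    simp

/-- Halving the real function `L = log S` into conjugate one-sided parts `g + star g` and
exponentiating gives `H = e^g` with inverse `e^{-g}`. The cut at frequency `0` is harmless in the
Wiener algebra, so `g'` inherits the bound on `L'`, and so does `H' = g'H`. -/
theorem exists_spectralFactor_of_log (C K : ℝ) : ∃ K' : ℝ, ∀ S L L' : C(UnitAddCircle, ℂ),
    ‖S‖ ≤ C → (∀ x, (S x).im = 0) → (∀ x, 0 < (S x).re) → HasDerivCircle L L' →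
    (Summable fun n => ‖coeffCLM n L'‖) → wnorm L' ≤ K → (∀ x, L x = (Real.log (S x).re : ℝ)) →
    ∃ H G, IsSpectralFactor S H G ∧ ∑' n : ℤ, (1 + |(n : ℝ)|) * ‖coeffCLM n H‖ ≤ K' := by
  -- `W` bounds `wnorm H` by `HasDerivCircle.summable` with `‖H‖ ≤ C + 1` and `‖H'‖ ≤ K (C + 1)`;
  -- then `K * W` bounds `wnorm H'`.
  set W := (C + 1) + ((K * (C + 1)) ^ 2 + ∑' n : ℤ, 1 / (n : ℝ) ^ 2) with hW
  refine ⟨W + K * W, fun S L L' hSC him hre hL hL's hL'K hlog => ?_⟩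
  have hC : 0 ≤ C := (norm_nonneg _).trans hSC
  have hK : 0 ≤ K := (wnorm_nonneg _).trans hL'K
  have hLs := hL.summable.1
  set γ : ℤ → ℂ := fun n => if n < 0 then coeffCLM n L else if n = 0 then coeffCLM n L / 2 else 0
    with hγ
  have hγle : ∀ n, ‖γ n‖ ≤ ‖coeffCLM n L‖ := fun n => by
    simp only [hγ]
    split_ifs
    · exact le_rfl
    · rw [norm_div, Complex.norm_ofNat]; linarith [norm_nonneg (coeffCLM n L)]
    · simp
  have hγs : Summable fun n => ‖γ n‖ := hLs.of_nonneg_of_le (fun _ => norm_nonneg _) hγle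
  have hγle' : ∀ n : ℤ, ‖2 * Real.pi * Complex.I * n * γ n‖ ≤ ‖coeffCLM n L'‖ := fun n => by
    rw [hL.coeffCLM_eq, norm_mul, norm_mul _ (coeffCLM n L)]
    gcongr
    exact hγle n
  have hγs' : Summable fun n : ℤ => ‖2 * Real.pi * Complex.I * n * γ n‖ :=
    hL's.of_nonneg_of_le (fun _ => norm_nonneg _) hγle'
  set g := trigSeries γ with hg
  set g' := trigSeries (fun n => 2 * Real.pi * Complex.I * n * γ n) with hg'
  have hgd : HasDerivCircle g g' := hasDerivCircle_trigSeries hγs hγs'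
  have hgs : Summable fun n => ‖coeffCLM n g‖ := by
    simpa only [hg, coeffCLM_trigSeries hγs] using hγs
  have hg0 : ∀ n, 0 < n → coeffCLM n g = 0 := fun n hn => by
    rw [hg, coeffCLM_trigSeries hγs]
    simp only [hγ]
    rw [if_neg (by omega), if_neg (by omega)]
  have hg's : Summable fun n => ‖coeffCLM n g'‖ := by
    simpa only [hg', coeffCLM_trigSeries hγs'] using hγs'
  have hg'K0 : ∑' n : ℤ, ‖2 * Real.pi * Complex.I * n * γ n‖ ≤ K :=
    (hγs'.tsum_le_tsum hγle' hL's).trans hL'K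
  have hg'w : wnorm g' ≤ K := by
    simpa only [wnorm, hg', coeffCLM_trigSeries hγs'] using hg'K0
  have hg'n : ‖g'‖ ≤ K := (norm_trigSeries_le hγs').trans hg'K0
  have hLstar : star L = L := by
    ext x
    simp [hlog]
  have hsum : g + star g = L := by
    ext x
    have h1 : HasSum (fun n => coeffCLM n L * fourier n x) (L x) :=
      (ContinuousMap.evalCLM ℂ x).hasSum (hasSum_fourier hLs)
    have h2 := hasSum_trigSeries_apply hγs x
    have h3 : HasSum (fun n => star (γ (-n)) * fourier n x) (star (g x)) := by
      have := (Equiv.neg ℤ).hasSum_iff.2 h2.star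
      convert this using 2 with n
      have h5 : star (fourier (-n) x : ℂ) = fourier n x := by
        rw [Complex.star_def, ← fourier_neg, neg_neg]
      rw [Function.comp_apply, Equiv.neg_apply, star_mul', h5]
    refine (h2.add h3).unique ?_
    convert h1 using 2 with n
    rw [← add_mul]
    congr 1
    have h5 : star (coeffCLM (-n) L) = coeffCLM n L := by rw [← coeffCLM_star, hLstar]
    simp only [hγ]
    rcases lt_trichotomy n 0 with h | h | h
    · rw [if_pos h, if_neg (by omega), if_neg (by omega), star_zero, add_zero]
    · subst h
      simp only [lt_irrefl, if_false, neg_zero, if_true] at h5 ⊢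
      rw [star_div₀, h5]
      simp
    · rw [if_neg (by omega), if_neg (by omega), if_pos (by omega), h5, zero_add]
  have hHS : NormedSpace.exp g * star (NormedSpace.exp g) = S := by
    ext x
    simp only [ContinuousMap.mul_apply, ContinuousMap.star_apply, exp_apply]
    rw [Complex.star_def, ← Complex.exp_conj, ← Complex.exp_add]
    have := DFunLike.congr_fun hsum x
    simp only [ContinuousMap.add_apply, ContinuousMap.star_apply, Complex.star_def] at this
    rw [this, hlog, ← Complex.ofReal_exp, Real.exp_log (hre x)]
    exact Complex.ext (by simp) (by simp [him x])
  -- Since `|H|² = |S| ≤ C`, and `t² ≤ C` implies `t ≤ C + 1`.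
  have hHn : ‖NormedSpace.exp g‖ ≤ C + 1 := by
    refine (ContinuousMap.norm_le _ (by positivity)).2 fun x => ?_
    have h1 := congrArg norm (DFunLike.congr_fun hHS x)
    rw [ContinuousMap.mul_apply, ContinuousMap.star_apply, norm_mul, norm_star] at h1
    have h2 := S.norm_coe_le_norm x
    nlinarith [norm_nonneg (NormedSpace.exp g x)]
  have hHd := hgd.exp
  have hH'n : ‖g' * NormedSpace.exp g‖ ≤ K * (C + 1) := (norm_mul_le _ _).trans (by gcongr)
  obtain ⟨hHs, hHw⟩ := hHd.summable
  have hHW : wnorm (NormedSpace.exp g) ≤ W := hHw.trans (by rw [hW]; gcongr)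
  obtain ⟨hH's, hH'w⟩ := summable_coeffCLM_mul hg's hHs
  have hle : ∀ n : ℤ, (1 + |(n : ℝ)|) * ‖coeffCLM n (NormedSpace.exp g)‖ ≤
      ‖coeffCLM n (NormedSpace.exp g)‖ + ‖coeffCLM n (g' * NormedSpace.exp g)‖ := fun n => by
    rw [hHd.coeffCLM_eq, norm_two_pi_I_mul, add_mul, one_mul]
    have : 0 ≤ |(n : ℝ)| * ‖coeffCLM n (NormedSpace.exp g)‖ := by positivity
    nlinarith [Real.pi_gt_three]
  refine ⟨NormedSpace.exp g, NormedSpace.exp (-g), ⟨?_, hHS, fun n hn => coeffCLM_exp_eq_zero hgs hg0 hn,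
    fun n hn => coeffCLM_exp_eq_zero (by simpa using hgs) (fun n hn => by simp [hg0 n hn]) hn,
    (hgd.neg.exp).summable.1,
    (hHs.add hH's).of_nonneg_of_le (fun _ => by positivity) hle⟩, ?_⟩
  · ext x
    simp [exp_apply, ← Complex.exp_add]
  · refine (Summable.tsum_le_tsum hle ((hHs.add hH's).of_nonneg_of_le (fun _ => by positivity) hle)
      (hHs.add hH's)).trans ?_
    rw [hHs.tsum_add hH's]
    have h1 : wnorm (g' * NormedSpace.exp g) ≤ K * W :=
      hH'w.trans (mul_le_mul hg'w hHW (wnorm_nonneg _) hK)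
    exact add_le_add hHW h1

/-- Multiplication of the outer factor by a unimodular constant makes its mean positive. -/
theorem IsSpectralFactor.exists_normalized {S H G : C(UnitAddCircle, ℂ)}
    (h : IsSpectralFactor S H G) : ∃ H' G', IsSpectralFactor S H' G' ∧
      (∀ n, ‖coeffCLM n H'‖ = ‖coeffCLM n H‖) ∧
      coeffCLM 0 H' = (‖coeffCLM 0 H'‖ : ℝ) ∧ coeffCLM 0 H' ≠ 0 := by
  have h0 : coeffCLM 0 H ≠ 0 := by
    -- If the mean of `H` were zero, every product in the convolution giving the zeroth coefficient
    -- of `G * H = 1` would vanish.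
    intro h0
    have h1 := hasSum_coeffCLM_mul h.summable_inv H 0
    rw [mul_comm, h.mul_eq_one] at h1
    have : (1 : C(UnitAddCircle, ℂ)) = fourier 0 := by ext x; simp
    rw [this, coeffCLM_fourier, if_pos rfl] at h1
    refine one_ne_zero (h1.unique ?_)
    convert hasSum_zero with j
    rcases lt_trichotomy j 0 with hj | hj | hj
    · rw [h.coeff_eq_zero _ (by omega), mul_zero]
    · subst hj; rw [sub_zero, h0, mul_zero]
    · rw [h.coeff_inv_eq_zero _ hj, zero_mul]
  set a := coeffCLM 0 H with ha
  set θ : ℂ := star a / (‖a‖ : ℝ) with hθ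
  have hna : (‖a‖ : ℂ) ≠ 0 := by simpa using h0
  have hθn : ‖θ‖ = 1 := by
    rw [hθ, norm_div, norm_star, Complex.norm_real, norm_norm, div_self (by simpa using h0)]
  have hθs : θ * star θ = 1 := by
    rw [Complex.star_def, Complex.mul_conj, Complex.normSq_eq_norm_sq, hθn]; simp
  have hθa : θ * a = (‖a‖ : ℝ) := by
    rw [hθ, div_mul_eq_mul_div, Complex.star_def, Complex.conj_mul', pow_two]
    field_simp
  have hn : ∀ n, ‖coeffCLM n (θ • H)‖ = ‖coeffCLM n H‖ := fun n => by
    rw [map_smul, norm_smul, hθn, one_mul]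
  refine ⟨θ • H, star θ • G, ⟨?_, ?_, fun n hn => ?_, fun n hn => ?_, ?_, ?_⟩, hn, ?_, ?_⟩
  · rw [smul_mul_smul_comm, hθs, h.mul_eq_one, one_smul]
  · rw [star_smul, smul_mul_smul_comm, hθs, one_smul, h.mul_star_eq]
  · rw [map_smul, h.coeff_eq_zero n hn, smul_zero]
  · rw [map_smul, h.coeff_inv_eq_zero n hn, smul_zero]
  · simpa only [map_smul, norm_smul, norm_star, hθn, one_mul] using h.summable_inv
  · simpa only [hn] using h.summable
  · rw [hn, map_smul, smul_eq_mul, ← ha, hθa]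
  · rw [map_smul, smul_eq_mul, ← ha, hθa]
    simpa using h0

/-- A function with a summable weighted Fourier series, bounded below by a positive constant, has a
spectral factor, with a bound that depends only on the constants. -/
theorem exists_spectralFactor (C smin : ℝ) (hs : 0 < smin) : ∃ K : ℝ, ∀ c : ℤ → ℂ,
    (Summable fun n : ℤ => (1 + |(n : ℝ)|) * ‖c n‖) → ∑' n : ℤ, (1 + |(n : ℝ)|) * ‖c n‖ ≤ C →
    (∀ n, c (-n) = star (c n)) → (∀ x, smin ≤ (trigSeries c x).re) →
    ∃ H G, IsSpectralFactor (trigSeries c) H G ∧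
      ∑' n : ℤ, (1 + |(n : ℝ)|) * ‖coeffCLM n H‖ ≤ K ∧
      coeffCLM 0 H = (‖coeffCLM 0 H‖ : ℝ) ∧ coeffCLM 0 H ≠ 0 := by
  -- The factor `7` exceeds `2π`, so `7 * C` bounds the series of `S` and of `S'` alike.
  obtain ⟨K₁, hK₁⟩ := exists_log_bound (7 * C) smin hs
  obtain ⟨K₂, hK₂⟩ := exists_spectralFactor_of_log (7 * C) K₁
  refine ⟨K₂, fun c hc hcC hstar hre => ?_⟩
  have hle1 : ∀ n : ℤ, ‖c n‖ ≤ (1 + |(n : ℝ)|) * ‖c n‖ := fun n =>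
    le_mul_of_one_le_left (norm_nonneg _) (by linarith [abs_nonneg (n : ℝ)])
  have hle2 : ∀ n : ℤ, ‖2 * Real.pi * Complex.I * n * c n‖ ≤ 7 * ((1 + |(n : ℝ)|) * ‖c n‖) := by
    intro n
    rw [norm_two_pi_I_mul]
    have h1 : 0 ≤ |(n : ℝ)| * ‖c n‖ := by positivity
    nlinarith [Real.pi_lt_d2, norm_nonneg (c n)]
  have h1 : Summable fun n => ‖c n‖ := hc.of_nonneg_of_le (fun _ => norm_nonneg _) hle1
  have h2 : Summable fun n : ℤ => ‖2 * Real.pi * Complex.I * n * c n‖ :=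
    (hc.mul_left 7).of_nonneg_of_le (fun _ => norm_nonneg _) hle2
  have hC : 0 ≤ C := (tsum_nonneg fun n => by positivity).trans hcC
  have h1C : ∑' n, ‖c n‖ ≤ 7 * C := (h1.tsum_le_tsum hle1 hc).trans (by linarith)
  have h2C : ∑' n : ℤ, ‖2 * Real.pi * Complex.I * n * c n‖ ≤ 7 * C :=
    (h2.tsum_le_tsum hle2 (hc.mul_left 7)).trans (by rw [tsum_mul_left]; gcongr)
  have hSstar : ∀ x, star (trigSeries c x) = trigSeries c x := fun x => by
    have h3 := hasSum_trigSeries_apply h1 x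
    refine HasSum.unique ?_ h3
    have := (Equiv.neg ℤ).hasSum_iff.2 h3.star
    convert this using 2 with n
    simp [hstar]
  have him : ∀ x, (trigSeries c x).im = 0 := fun x => Complex.conj_eq_iff_im.1 (hSstar x)
  have hSn := (norm_trigSeries_le h1).trans h1C
  obtain ⟨L, L', hL, hL's, hL'w, hlog⟩ := hK₁ _ _ (hasDerivCircle_trigSeries h1 h2) hSn
    (by simpa only [coeffCLM_trigSeries h2] using h2) ((norm_trigSeries_le h2).trans h2C)
    (by simpa only [wnorm, coeffCLM_trigSeries h2] using h2C) him hre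
  obtain ⟨H, G, hHG, hHK⟩ := hK₂ _ L L' hSn him (fun x => hs.trans_le (hre x)) hL hL's hL'w hlog
  obtain ⟨H', G', hHG', hn, h3⟩ := hHG.exists_normalized
  exact ⟨H', G', hHG', by simpa only [hn] using hHK, h3⟩

end BartlettApprox

namespace BartlettApprox

open AddCircle

/-! ### Stationary sequences in a Hilbert space -/

theorem hasSum_of_forall_eq {ι M : Type*} [AddCommMonoid M] [TopologicalSpace M] {f g : ι → M} {a : M}
    (h : HasSum f a) (hfg : ∀ i, f i = g i) : HasSum g a := funext hfg ▸ h

section Hilbert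

variable {E : Type*} [NormedAddCommGroup E] [InnerProductSpace ℂ E] [CompleteSpace E]

omit [CompleteSpace E] in
theorem mem_of_hasSum_of_isClosed {ι : Type*} {U : Submodule ℂ E} (hU : IsClosed (U : Set E))
    {f : ι → E} {x : E} (h : HasSum f x) (hf : ∀ i, f i ∈ U) : x ∈ U :=
  hU.mem_of_tendsto h (Eventually.of_forall fun _ => U.sum_mem fun i _ => hf i)

/-- The element `∑ F_u Y_u` associated with `F = ∑ F_u e^{2iπu·}`. -/
noncomputable def spectralSum (Y : ℤ → E) (F : C(UnitAddCircle, ℂ)) : E :=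
  ∑' u, coeffCLM u F • Y u

variable {Y : ℤ → E} {S : C(UnitAddCircle, ℂ)}
  (hY : ∀ m n, inner ℂ (Y m) (Y n) = coeffCLM (m - n) S)

include hY

omit [CompleteSpace E] in
theorem norm_le_of_inner_eq (n : ℤ) : ‖Y n‖ ≤ ‖S‖ + 1 := by
  have h1 : ‖Y n‖ ^ 2 = ‖coeffCLM 0 S‖ := by
    have := hY n n
    rw [sub_self, inner_self_eq_norm_sq_to_K] at this
    rw [← this]; simp
  have h2 := norm_coeffCLM_le 0 S
  nlinarith [norm_nonneg (Y n)]

theorem hasSum_spectralSum {F : C(UnitAddCircle, ℂ)} (hF : Summable fun n => ‖coeffCLM n F‖) :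
    HasSum (fun u => coeffCLM u F • Y u) (spectralSum Y F) := by
  refine (Summable.of_norm ?_).hasSum
  refine (hF.mul_right (‖S‖ + 1)).of_nonneg_of_le (fun _ => norm_nonneg _) fun u => ?_
  rw [norm_smul]
  gcongr
  exact norm_le_of_inner_eq hY u

theorem inner_spectralSum {F : C(UnitAddCircle, ℂ)} (hF : Summable fun n => ‖coeffCLM n F‖) (m : ℤ) :
    inner ℂ (Y m) (spectralSum Y F) = coeffCLM m (F * S) := by
  have h := (innerSL ℂ (Y m)).hasSum (hasSum_spectralSum hY hF)
  simp only [map_smul, innerSL_apply_apply, hY, smul_eq_mul] at h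
  exact h.unique (hasSum_coeffCLM_mul hF S m)

/-- This is the spectral isometry: the right side is the inner product of `G` and `F` in `L²(S dν)`.
-/
theorem inner_spectralSum_spectralSum {F G : C(UnitAddCircle, ℂ)}
    (hF : Summable fun n => ‖coeffCLM n F‖) (hG : Summable fun n => ‖coeffCLM n G‖) :
    inner ℂ (spectralSum Y G) (spectralSum Y F) = coeffCLM 0 (star G * (F * S)) := by
  have h := (innerSL ℂ (spectralSum Y F)).hasSum (hasSum_spectralSum hY hG)
  simp only [map_smul, innerSL_apply_apply, smul_eq_mul] at h
  have h2 := h.star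
  simp only [star_mul', Complex.star_def, inner_conj_symm, inner_spectralSum hY hF] at h2
  refine h2.unique ?_
  have hG' : Summable fun n => ‖coeffCLM n (star G)‖ := by
    simp only [coeffCLM_star, norm_star]
    exact (Equiv.neg ℤ).summable_iff.2 hG
  have h3 := (Equiv.neg ℤ).hasSum_iff.2 (hasSum_coeffCLM_mul hG' (F * S) 0)
  refine hasSum_of_forall_eq (h3) fun u => ?_
  simp [coeffCLM_star]

omit hY in
theorem summable_coeffCLM_fourier_mul {F : C(UnitAddCircle, ℂ)}
    (hF : Summable fun n => ‖coeffCLM n F‖) (k : ℤ) :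
    Summable fun n => ‖coeffCLM n (fourier k * F)‖ := by
  simp only [coeffCLM_fourier_mul]
  exact (Equiv.subRight k).summable_iff.2 hF

/-- The innovation representation of a stationary sequence whose spectral density is factored. -/
theorem exists_innovation {H G : C(UnitAddCircle, ℂ)} (hHG : IsSpectralFactor S H G) :
    ∃ η : ℤ → E, Orthonormal ℂ η ∧
      (∀ n, η n ∈ (Submodule.span ℂ (Y '' Set.Iic n)).topologicalClosure) ∧
      ∀ n, HasSum (fun k : ℕ => coeffCLM (-(k : ℤ)) H • η (n - k)) (Y n) := by
  have hG := hHG.summable_inv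
  have hGn := summable_coeffCLM_fourier_mul hG
  have hHs : Summable fun n => ‖coeffCLM n H‖ :=
    hHG.summable.of_nonneg_of_le (fun _ => norm_nonneg _) fun n =>
      le_mul_of_one_le_left (norm_nonneg _) (by linarith [abs_nonneg (n : ℝ)])
  have hGS : G * S = star H := by
    rw [← hHG.mul_star_eq, ← mul_assoc, mul_comm G, hHG.mul_eq_one, one_mul]
  have hstarGH : star G * star H = 1 := by
    refine (star_mul' G H).symm.trans ?_
    rw [mul_comm, hHG.mul_eq_one, star_one]
  set η : ℤ → E := fun n => spectralSum Y (fourier n * G) with hη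
  have hon : Orthonormal ℂ η := by
    rw [orthonormal_iff_ite]
    intro m n
    rw [hη]
    dsimp only
    rw [inner_spectralSum_spectralSum hY (hGn n) (hGn m)]
    have : star (fourier m * G) * (fourier n * G * S) = (fourier (-m + n) : C(UnitAddCircle, ℂ)) := by
      rw [star_mul', star_fourier, mul_assoc (fourier n), hGS, ← fourier_mul_fourier,
        mul_mul_mul_comm, hstarGH, mul_one]
    rw [this, coeffCLM_fourier]
    congr 1
    simp only [eq_iff_iff]
    omega
  have hcoef : ∀ (n : ℤ) (k : ℕ), inner ℂ (η (n - k)) (Y n) = coeffCLM (-(k : ℤ)) H := by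
    intro n k
    rw [← inner_conj_symm, inner_spectralSum hY (hGn _), mul_assoc, hGS, coeffCLM_fourier_mul,
      coeffCLM_star]
    simp
  refine ⟨η, hon, fun n => ?_, fun n => ?_⟩
  · refine mem_of_hasSum_of_isClosed (Submodule.isClosed_topologicalClosure _)
      (hasSum_spectralSum hY (hGn n)) fun u => ?_
    rcases le_or_gt u n with hu | hu
    · exact Submodule.smul_mem _ _ (Submodule.le_topologicalClosure _
        (Submodule.subset_span ⟨u, hu, rfl⟩))
    · rw [coeffCLM_fourier_mul, hHG.coeff_inv_eq_zero _ (by omega), zero_smul]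
      exact Submodule.zero_mem _
  · have hinj : Function.Injective fun k : ℕ => -(k : ℤ) := fun a b h => by simpa using h
    have has : Summable fun k : ℕ => ‖coeffCLM (-(k : ℤ)) H‖ := hHs.comp_injective hinj
    have hsm : Summable fun k : ℕ => coeffCLM (-(k : ℤ)) H • η (n - k) :=
      Summable.of_norm (by simpa only [norm_smul, hon.1, mul_one] using has)
    obtain ⟨Z, hZ⟩ := hsm
    have hηZ : ∀ k : ℕ, inner ℂ (η (n - k)) Z = coeffCLM (-(k : ℤ)) H := by
      intro k
      have h := (innerSL ℂ (η (n - k))).hasSum hZ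
      simp only [map_smul, innerSL_apply_apply, smul_eq_mul, orthonormal_iff_ite.1 hon] at h
      refine h.unique ?_
      refine hasSum_of_forall_eq ((hasSum_ite_eq k (coeffCLM (-(k : ℤ)) H))) fun j => ?_
      by_cases hjk : j = k
      · simp [hjk]
      · rw [if_neg hjk, if_neg (by omega), mul_zero]
    -- Applied to `W = Z` and to `W = Y n`. Together with `‖Y n‖² = ∑ |a_k|²`, which comes from `S =
    -- |H|²`, it gives `‖Y n - Z‖ = 0` without any completeness statement for `η`.
    have hinner : ∀ W : E, (∀ k : ℕ, inner ℂ (η (n - k)) W = coeffCLM (-(k : ℤ)) H) →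
        HasSum (fun k : ℕ => ((‖coeffCLM (-(k : ℤ)) H‖ ^ 2 : ℝ) : ℂ)) (inner ℂ W Z) := by
      intro W hW
      have h := (innerSL ℂ W).hasSum hZ
      simp only [map_smul, innerSL_apply_apply, smul_eq_mul] at h
      refine hasSum_of_forall_eq (h) fun k => ?_
      rw [← inner_conj_symm, hW, Complex.mul_conj, Complex.normSq_eq_norm_sq]
    have h1 := hinner Z hηZ
    have h2 := hinner (Y n) (hcoef n)
    have h3 : inner ℂ (Y n) (Y n) = inner ℂ Z Z := by
      rw [hY, sub_self, ← hHG.mul_star_eq]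
      have h4 := hasSum_coeffCLM_mul hHs (star H) 0
      refine HasSum.unique ?_ h1
      have h5 := (hinj.hasSum_iff (fun j hj => ?_)).2 h4
      · refine hasSum_of_forall_eq (h5) fun k => ?_
        simp [coeffCLM_star, Complex.mul_conj, Complex.normSq_eq_norm_sq]
      · rw [hHG.coeff_eq_zero, zero_mul]
        by_contra hj'
        exact hj ⟨j.natAbs, by simp only; omega⟩
    have h6 : inner ℂ (Y n) Z = inner ℂ Z Z := h2.unique h1
    have h7 : inner ℂ Z (Y n) = inner ℂ Z Z := by
      rw [← inner_conj_symm, h6, inner_conj_symm]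
    have h8 : Y n - Z = 0 := by
      rw [← inner_self_eq_zero (𝕜 := ℂ)]
      simp only [inner_sub_left, inner_sub_right]
      rw [h3, h6, h7]; ring
    rwa [sub_eq_zero.1 h8]

omit hY

omit [CompleteSpace E] in
/-- The prediction error is the leading term of the innovation representation. -/
theorem sub_starProjection_eq {a : ℕ → ℂ} {η : ℤ → E} (hη : Orthonormal ℂ η)
    (hmem : ∀ n, η n ∈ (Submodule.span ℂ (Y '' Set.Iic n)).topologicalClosure)
    (hsum : ∀ n, HasSum (fun k : ℕ => a k • η (n - k)) (Y n)) (n : ℤ)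
    (U : Submodule ℂ E) [U.HasOrthogonalProjection]
    (hU : U = (Submodule.span ℂ (Y '' Set.Iio n)).topologicalClosure) :
    Y n - U.starProjection (Y n) = a 0 • η n := by
  have hUc : IsClosed (U : Set E) := hU ▸ Submodule.isClosed_topologicalClosure _
  have hmem' : ∀ k, k < n → η k ∈ U := fun k hk => by
    rw [hU]
    exact Submodule.topologicalClosure_mono (Submodule.span_mono
      (Set.image_mono fun j hj => lt_of_le_of_lt hj hk)) (hmem k)
  have h1 : HasSum (fun k : ℕ => a (k + 1) • η (n - (k + 1 : ℕ))) (Y n - a 0 • η n) := by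
    have := (hasSum_nat_add_iff' 1).2 (hsum n)
    simpa using this
  have h2 : Y n - a 0 • η n ∈ U := mem_of_hasSum_of_isClosed hUc h1 fun k =>
    U.smul_mem _ (hmem' _ (by push_cast; omega))
  -- For `k < n`, the expansion of `Y k` involves only `η j` with `j ≤ k`, all orthogonal to `η n`.
  have h3 : η n ∈ Uᗮ := by
    rw [hU, Submodule.orthogonal_closure, Submodule.mem_orthogonal]
    intro u hu
    induction hu using Submodule.span_induction with
    | mem x hx =>
      obtain ⟨k, hk, rfl⟩ := hx
      have h := (innerSL ℂ (η n)).hasSum (hsum k)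
      simp only [map_smul, innerSL_apply_apply, smul_eq_mul, orthonormal_iff_ite.1 hη] at h
      rw [← inner_conj_symm]
      have h0 : inner ℂ (η n) (Y k) = 0 := by
        refine h.unique ?_
        convert hasSum_zero with j
        have : k < n := hk
        rw [if_neg (by omega), mul_zero]
      rw [h0, map_zero]
    | zero => simp
    | add x y _ _ hx hy => rw [inner_add_left, hx, hy, add_zero]
    | smul c x _ hx => rw [inner_smul_left, hx, mul_zero]
  have h4 : U.starProjection (Y n) = Y n - a 0 • η n :=
    Submodule.eq_starProjection_of_mem_orthogonal h2 (by
      rw [sub_sub_cancel]; exact Submodule.smul_mem _ _ h3)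
  rw [h4, sub_sub_cancel]

/-- The normalized Fourier transform of a sequence of vectors. -/
noncomputable def vectorDft (N : ℕ) (v : ℤ → E) (ν : ℝ) : E :=
  (1 / (Real.sqrt N : ℂ)) • ∑ n ∈ Finset.Icc 1 N,
    Complex.exp (-2 * Real.pi * Complex.I * ((n : ℂ) - 1) * ν) • v (n : ℤ)

theorem norm_exp_eq_one (t ν : ℝ) : ‖Complex.exp (-2 * Real.pi * Complex.I * (t : ℂ) * ν)‖ = 1 := by
  have : (-2 * Real.pi * Complex.I * (t : ℂ) * ν) = ((-2 * Real.pi * t * ν : ℝ) : ℂ) * Complex.I := by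
    push_cast; ring
  rw [this, Complex.norm_exp_ofReal_mul_I]

omit [CompleteSpace E] in
theorem norm_vectorDft_le_one (N : ℕ) {η : ℤ → E} (hη : Orthonormal ℂ η) (ν : ℝ) :
    ‖vectorDft N η ν‖ ≤ 1 := by
  have hη' : Orthonormal ℂ fun n : ℕ => η n := hη.comp _ Nat.cast_injective
  have h1 : ‖∑ n ∈ Finset.Icc 1 N,
      Complex.exp (-2 * Real.pi * Complex.I * ((n : ℂ) - 1) * ν) • η (n : ℤ)‖ ^ 2 = N := by
    rw [@norm_sq_eq_re_inner ℂ, hη'.inner_sum]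
    have : ∀ n : ℕ, (starRingEnd ℂ) (Complex.exp (-2 * Real.pi * Complex.I * ((n : ℂ) - 1) * ν)) *
        Complex.exp (-2 * Real.pi * Complex.I * ((n : ℂ) - 1) * ν) = 1 := fun n => by
      have h := norm_exp_eq_one ((n : ℝ) - 1) ν
      push_cast at h
      rw [Complex.conj_mul', h]; simp
    simp only [this]
    simp
  have h2 : ‖∑ n ∈ Finset.Icc 1 N,
      Complex.exp (-2 * Real.pi * Complex.I * ((n : ℂ) - 1) * ν) • η (n : ℤ)‖ = Real.sqrt N := by
    rw [← h1, Real.sqrt_sq (norm_nonneg _)]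
  rw [vectorDft, norm_smul, h2, norm_div, norm_one, Complex.norm_real, Real.norm_of_nonneg
    (Real.sqrt_nonneg _), one_div]
  -- The norm is `1` for `N ≥ 1`; the inequality also covers `N = 0`, where it is `0`.
  exact inv_mul_le_one

-- A shift by one changes the sum by two boundary terms of norm at most `1`; these changes are added
-- `k` times.
omit [InnerProductSpace ℂ E] [CompleteSpace E] in
theorem norm_sum_shift_sub_le {w : ℤ → E} (hw : ∀ n, ‖w n‖ ≤ 1) (N k : ℕ) :
    ‖∑ n ∈ Finset.Icc 1 N, w ((n : ℤ) - k) - ∑ n ∈ Finset.Icc 1 N, w n‖ ≤ 2 * k := by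
  have htel : ∀ (w : ℤ → E), ∑ n ∈ Finset.Icc 1 N, w ((n : ℤ) - 1) - ∑ n ∈ Finset.Icc 1 N, w n =
      w 0 - w N := by
    intro w
    induction N with
    | zero => simp
    | succ N ih =>
      rw [Finset.sum_Icc_succ_top (by omega), Finset.sum_Icc_succ_top (by omega), add_sub_add_comm,
        ih]
      push_cast
      rw [add_sub_cancel_right]
      abel
  induction k with
  | zero => simp
  | succ k ih =>
    have h := htel fun n => w (n - k)
    have h2 : ∑ n ∈ Finset.Icc 1 N, w ((n : ℤ) - (k + 1 : ℕ)) - ∑ n ∈ Finset.Icc 1 N, w n =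
        (w (0 - k) - w (N - k)) +
          (∑ n ∈ Finset.Icc 1 N, w ((n : ℤ) - k) - ∑ n ∈ Finset.Icc 1 N, w n) := by
      rw [← h]
      have : ∀ n : ℕ, (n : ℤ) - (k + 1 : ℕ) = n - 1 - k := fun n => by push_cast; ring
      simp only [this]
      abel
    rw [h2]
    refine (norm_add_le _ _).trans ?_
    have := (norm_sub_le (w (0 - k)) (w (N - k))).trans (add_le_add (hw _) (hw _))
    push_cast
    linarith

omit [CompleteSpace E] in
/-- The Fourier transform of a linear process is close to that of its innovations, filtered. -/
theorem norm_vectorDft_sub_le {a : ℕ → ℂ} {η : ℤ → E} (hη : ∀ n, ‖η n‖ = 1)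
    (hsum : ∀ n, HasSum (fun k : ℕ => a k • η (n - k)) (Y n))
    (ha : Summable fun k : ℕ => (1 + (k : ℝ)) * ‖a k‖) (N : ℕ) (ν : ℝ) :
    ‖vectorDft N Y ν - (∑' k : ℕ, a k * Complex.exp (-2 * Real.pi * Complex.I * k * ν)) •
      vectorDft N η ν‖ ≤ 2 / Real.sqrt N * ∑' k : ℕ, (1 + (k : ℝ)) * ‖a k‖ := by
  have hle : ∀ k : ℕ, ‖a k‖ ≤ (1 + (k : ℝ)) * ‖a k‖ := fun k =>
    le_mul_of_one_le_left (norm_nonneg _) (by linarith [k.cast_nonneg (α := ℝ)])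
  have ha' : Summable fun k => ‖a k‖ := ha.of_nonneg_of_le (fun _ => norm_nonneg _) hle
  set e : ℕ → ℂ := fun k => Complex.exp (-2 * Real.pi * Complex.I * k * ν) with he
  have hen : ∀ k, ‖e k‖ = 1 := fun k => norm_exp_eq_one k ν
  have hh : HasSum (fun k => a k * e k) (∑' k : ℕ, a k * e k) :=
    (Summable.of_norm (by simpa only [norm_mul, hen, mul_one] using ha')).hasSum
  set w : ℤ → E := fun n => Complex.exp (-2 * Real.pi * Complex.I * ((n : ℂ) - 1) * ν) • η n with hw
  have hwn : ∀ n, ‖w n‖ ≤ 1 := fun n => by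
    have h := norm_exp_eq_one ((n : ℝ) - 1) ν
    push_cast at h
    rw [hw]; dsimp only
    rw [norm_smul, h, hη, one_mul]
  -- The phase at time `n` splits into the phase at time `n - k`, absorbed in `w`, and the factor `e
  -- k` of the transfer function.
  have h1 : ∀ n : ℤ, HasSum (fun k : ℕ => (a k * e k) • w (n - k))
      (Complex.exp (-2 * Real.pi * Complex.I * ((n : ℂ) - 1) * ν) • Y n) := fun n => by
    have h := (hsum n).const_smul (Complex.exp (-2 * Real.pi * Complex.I * ((n : ℂ) - 1) * ν))
    convert h using 2 with k
    simp only [hw, he, smul_smul]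
    congr 1
    rw [mul_assoc, ← Complex.exp_add, mul_comm]
    congr 2
    push_cast; ring
  have h2 : HasSum (fun k : ℕ => (a k * e k) •
      (∑ n ∈ Finset.Icc 1 N, w ((n : ℤ) - k) - ∑ n ∈ Finset.Icc 1 N, w n))
      (∑ n ∈ Finset.Icc 1 N, Complex.exp (-2 * Real.pi * Complex.I * ((n : ℂ) - 1) * ν) • Y n -
        (∑' k : ℕ, a k * e k) • ∑ n ∈ Finset.Icc 1 N, w n) := by
    have h3 := hasSum_sum (s := Finset.Icc 1 N) fun (n : ℕ) _ => h1 n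
    have h4 := h3.sub (hh.smul_const (∑ n ∈ Finset.Icc 1 N, w (n : ℤ)))
    simp only [Int.cast_natCast] at h4
    refine hasSum_of_forall_eq (h4) fun k => ?_
    rw [smul_sub, Finset.smul_sum, Finset.smul_sum]
  have h3 : vectorDft N Y ν - (∑' k : ℕ, a k * e k) • vectorDft N η ν = (1 / (Real.sqrt N : ℂ)) •
      (∑ n ∈ Finset.Icc 1 N, Complex.exp (-2 * Real.pi * Complex.I * ((n : ℂ) - 1) * ν) • Y n -
        (∑' k : ℕ, a k * e k) • ∑ n ∈ Finset.Icc 1 N, w n) := by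
    rw [smul_sub, smul_comm]
    rfl
  have h4 : ∀ k : ℕ, ‖(a k * e k) •
      (∑ n ∈ Finset.Icc 1 N, w ((n : ℤ) - k) - ∑ n ∈ Finset.Icc 1 N, w n)‖ ≤
      2 * ((1 + (k : ℝ)) * ‖a k‖) := fun k => by
    rw [norm_smul, norm_mul, hen, mul_one]
    have := norm_sum_shift_sub_le hwn N k
    nlinarith [norm_nonneg (a k)]
  have h5 := (ha.mul_left 2).of_nonneg_of_le (fun _ => norm_nonneg _) h4
  rw [h3, norm_smul, ← h2.tsum_eq, norm_div, norm_one, Complex.norm_real, Real.norm_of_nonneg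
    (Real.sqrt_nonneg _)]
  have h6 := (norm_tsum_le_tsum_norm h5).trans (h5.tsum_le_tsum h4 (ha.mul_left 2))
  rw [tsum_mul_left] at h6
  calc _ ≤ 1 / Real.sqrt N * (2 * ∑' k : ℕ, (1 + (k : ℝ)) * ‖a k‖) := by gcongr
    _ = _ := by ring

end Hilbert

end BartlettApprox

namespace BartlettApprox

variable {Ω : Type*} [MeasurableSpace Ω]

/-! ### Moments of Gaussian variables -/

theorem eLpNorm_of_map_eq_gaussianReal {P : Measure Ω} {X : Ω → ℝ} {v : ℝ≥0}
    (hX : P.map X = gaussianReal 0 v) (q : ℝ≥0∞) :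
    AEMeasurable X P ∧
      eLpNorm X q P = ‖Real.sqrt v‖ₑ * eLpNorm (id : ℝ → ℝ) q (gaussianReal 0 1) := by
  -- The push-forward under a map that is not a.e. measurable is `0` by convention, unlike a
  -- Gaussian law.
  have hm : AEMeasurable X P := aemeasurable_of_map_neZero (by rw [hX]; infer_instance)
  refine ⟨hm, ?_⟩
  have h1 : eLpNorm X q P = eLpNorm (id : ℝ → ℝ) q (P.map X) :=
    (eLpNorm_map_measure aestronglyMeasurable_id hm).symm
  have h2 : gaussianReal 0 v = (gaussianReal 0 1).map (Real.sqrt v * ·) := by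
    rw [gaussianReal_map_const_mul, mul_zero]
    congr 1
    ext
    simp
  rw [h1, hX, h2, eLpNorm_map_measure aestronglyMeasurable_id (by fun_prop), ← eLpNorm_const_smul]
  rfl

theorem eLpNorm_id_gaussianReal_ne_zero :
    eLpNorm (id : ℝ → ℝ) 2 (gaussianReal 0 1) ≠ 0 := by
  intro h
  rw [eLpNorm_eq_zero_iff aestronglyMeasurable_id two_ne_zero] at h
  have hna := nullSingletonClass_gaussianReal (μ := 0) (v := 1) one_ne_zero
  have h1 : gaussianReal 0 1 {(0 : ℝ)}ᶜ = 0 := h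
  have h2 : gaussianReal 0 1 {(0 : ℝ)} = 0 := measure_singleton 0
  have h3 : gaussianReal 0 1 Set.univ ≤ 0 := by
    rw [← Set.union_compl_self {(0 : ℝ)}]
    exact (measure_union_le _ _).trans (by rw [h1, h2, add_zero])
  simp at h3

/-- The ratio of the `L^q` and `L²` norms of a complex Gaussian variable is at most this. -/
noncomputable def gaussianMoment (q : ℝ≥0∞) : ℝ≥0∞ :=
  2 * eLpNorm (id : ℝ → ℝ) q (gaussianReal 0 1) / eLpNorm (id : ℝ → ℝ) 2 (gaussianReal 0 1)

theorem gaussianMoment_ne_top {q : ℝ≥0∞} (hq : q ≠ ∞) : gaussianMoment q ≠ ∞ :=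
  ENNReal.div_ne_top (ENNReal.mul_ne_top ENNReal.ofNat_ne_top (memLp_id_gaussianReal' q hq).2.ne)
    eLpNorm_id_gaussianReal_ne_zero

theorem IsComplexGaussian.aestronglyMeasurable {P : Measure Ω} {Z : Ω → ℂ} {v : ℝ≥0}
    (hZ : IsComplexGaussian P Z v) : AEStronglyMeasurable Z P := by
  have h1 := (eLpNorm_of_map_eq_gaussianReal hZ.1 2).1
  have h2 := (eLpNorm_of_map_eq_gaussianReal hZ.2.1 2).1
  have h3 : Z = fun ω => ((Z ω).re : ℂ) + ((Z ω).im : ℂ) * Complex.I := by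
    funext ω; exact (Complex.re_add_im _).symm
  rw [h3]
  exact AEMeasurable.aestronglyMeasurable (by fun_prop)

/-- Both parts are distributed as the same multiple of a standard Gaussian. The triangle inequality
bounds the `L^q` norm above, and the real part alone bounds the `L²` norm below. -/
theorem IsComplexGaussian.eLpNorm_le {P : Measure Ω} {Z : Ω → ℂ} {v : ℝ≥0}
    (hZ : IsComplexGaussian P Z v) {q : ℝ≥0∞} (hq : 1 ≤ q) :
    eLpNorm Z q P ≤ gaussianMoment q * eLpNorm Z 2 P := by
  obtain ⟨hrm, hrq⟩ := eLpNorm_of_map_eq_gaussianReal hZ.1 q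
  obtain ⟨him, hiq⟩ := eLpNorm_of_map_eq_gaussianReal hZ.2.1 q
  obtain ⟨-, hr2⟩ := eLpNorm_of_map_eq_gaussianReal hZ.1 2
  set κ := eLpNorm (id : ℝ → ℝ) q (gaussianReal 0 1)
  set κ₂ := eLpNorm (id : ℝ → ℝ) 2 (gaussianReal 0 1) with hκ₂
  have hκ₂0 : κ₂ ≠ 0 := eLpNorm_id_gaussianReal_ne_zero
  have hκ₂t : κ₂ ≠ ∞ := (memLp_id_gaussianReal' 2 ENNReal.ofNat_ne_top).2.ne
  set σ := ‖Real.sqrt (v / 2 : ℝ≥0)‖ₑ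
  have h1 : σ * κ₂ ≤ eLpNorm Z 2 P := by
    rw [← hr2]
    exact eLpNorm_mono fun ω => Complex.abs_re_le_norm (Z ω)
  have h2 : eLpNorm Z q P ≤ σ * κ + σ * κ := by
    rw [← hrq]
    nth_rw 2 [hrq]
    rw [← hiq]
    have h3 : ∀ ω, ‖Z ω‖ ≤ ‖((fun ω => |(Z ω).re|) + fun ω => |(Z ω).im|) ω‖ := fun ω => by
      rw [Pi.add_apply, Real.norm_of_nonneg (by positivity)]
      exact Complex.norm_le_abs_re_add_abs_im _
    refine (eLpNorm_mono h3).trans ((eLpNorm_add_le ?_ ?_ hq).trans_eq ?_)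
    · exact hrm.abs.aestronglyMeasurable
    · exact him.abs.aestronglyMeasurable
    · congr 1
      · exact eLpNorm_norm (fun ω => (Z ω).re)
      · exact eLpNorm_norm (fun ω => (Z ω).im)
  refine h2.trans ?_
  calc σ * κ + σ * κ = 2 * κ / κ₂ * (σ * κ₂) := by
        rw [ENNReal.div_eq_inv_mul, ← two_mul,
          show κ₂⁻¹ * (2 * κ) * (σ * κ₂) = (κ₂⁻¹ * κ₂) * (2 * (σ * κ)) by ring,
          ENNReal.inv_mul_cancel hκ₂0 hκ₂t, one_mul]
    _ ≤ _ := by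
      rw [gaussianMoment]
      gcongr

variable {P : Measure Ω} {x : ℤ → Ω → ℂ}

theorem IsComplexGaussianProcess.exists_isComplexGaussian (hx : IsComplexGaussianProcess P x)
    (n : ℤ) : ∃ v, IsComplexGaussian P (x n) v := by
  obtain ⟨v, hv⟩ := hx (Finsupp.single n 1)
  refine ⟨v, ?_⟩
  convert hv using 1
  funext ω
  change x n ω = (Finsupp.single n (1 : ℂ)).sum fun m a => a * x m ω
  rw [Finsupp.sum_single_index (zero_mul _), one_mul]

theorem IsComplexGaussianProcess.memLp (hx : IsComplexGaussianProcess P x) (n : ℤ) :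
    MemLp (x n) 2 P := by
  obtain ⟨v, hv⟩ := hx.exists_isComplexGaussian n
  refine memLp_re_im_iff.1 ⟨⟨?_, ?_⟩, ⟨?_, ?_⟩⟩
  · exact (eLpNorm_of_map_eq_gaussianReal hv.1 2).1.aestronglyMeasurable
  · refine (eLpNorm_of_map_eq_gaussianReal hv.1 2).2.trans_lt ?_
    exact ENNReal.mul_lt_top enorm_lt_top (memLp_id_gaussianReal' 2 ENNReal.ofNat_ne_top).2
  · exact (eLpNorm_of_map_eq_gaussianReal hv.2.1 2).1.aestronglyMeasurable
  · refine (eLpNorm_of_map_eq_gaussianReal hv.2.1 2).2.trans_lt ?_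
    exact ENNReal.mul_lt_top enorm_lt_top (memLp_id_gaussianReal' 2 ENNReal.ofNat_ne_top).2

theorem IsComplexGaussianProcess.coeFn_toL2 (hx : IsComplexGaussianProcess P x) (n : ℤ) :
    toL2 P (x n) =ᵐ[P] x n := by
  rw [toL2, dif_pos (hx.memLp n)]
  exact MemLp.coeFn_toLp _

/-- The closed linear span of a series in `L²`. -/
noncomputable def gaussianSpan (P : Measure Ω) (x : ℤ → Ω → ℂ) : Submodule ℂ (Lp ℂ 2 P) :=
  (Submodule.span ℂ (Set.range fun n => toL2 P (x n))).topologicalClosure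

/-- All the `L^q` norms are equivalent on the closed span of a Gaussian process. -/
theorem IsComplexGaussianProcess.eLpNorm_le (hx : IsComplexGaussianProcess P x) {q : ℝ≥0∞}
    (hq : 1 ≤ q) (hq' : q ≠ ∞) {Z : Lp ℂ 2 P} (hZ : Z ∈ gaussianSpan P x) :
    eLpNorm Z q P ≤ gaussianMoment q * ‖Z‖ₑ := by
  have hspan : ∀ W ∈ Submodule.span ℂ (Set.range fun n => toL2 P (x n)),
      eLpNorm W q P ≤ gaussianMoment q * ‖W‖ₑ := by
    intro W hW
    obtain ⟨c, rfl⟩ := Finsupp.mem_span_range_iff_exists_finsupp.1 hW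
    obtain ⟨v, hv⟩ := hx c
    have hae : (c.sum fun n a => a • toL2 P (x n) : Lp ℂ 2 P) =ᵐ[P]
        fun ω => ∑ n ∈ c.support, c n * x n ω := by
      rw [Finsupp.sum]
      refine (Lp.coeFn_finsetSum _ _).trans ?_
      have h1 : ∀ᵐ ω ∂P, ∀ n ∈ c.support, (c n • toL2 P (x n) : Lp ℂ 2 P) ω = c n * x n ω := by
        rw [Finset.eventually_all]
        intro n _
        filter_upwards [Lp.coeFn_smul (c n) (toL2 P (x n)), hx.coeFn_toL2 n] with ω h1 h2
        rw [h1, Pi.smul_apply, h2, smul_eq_mul]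
      filter_upwards [h1] with ω h1
      rw [Finset.sum_apply]
      exact Finset.sum_congr rfl h1
    rw [Lp.enorm_def, eLpNorm_congr_ae hae, eLpNorm_congr_ae hae]
    exact hv.eLpNorm_le hq
  -- The bound on finite combinations passes to the closure by Fatou's lemma, along an a.e.
  -- convergent subsequence.
  obtain ⟨W, hW, hlim⟩ := mem_closure_iff_seq_limit.1 hZ
  obtain ⟨ns, hns, hae⟩ := (tendstoInMeasure_of_tendsto_Lp hlim).exists_seq_tendsto_ae
  refine (Lp.eLpNorm_lim_le_liminf_eLpNorm (fun k => (Lp.aestronglyMeasurable (W (ns k)))) Z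
    hae).trans ?_
  have h1 : Tendsto (fun k => gaussianMoment q * ‖W (ns k)‖ₑ) atTop
      (𝓝 (gaussianMoment q * ‖Z‖ₑ)) :=
    ENNReal.Tendsto.const_mul ((hlim.comp hns.tendsto_atTop).enorm)
      (Or.inr (gaussianMoment_ne_top hq'))
  rw [← h1.liminf_eq]
  exact liminf_le_liminf (Eventually.of_forall fun k => hspan _ (hW _))

/-- Tail bound for a variable in the closed span of a Gaussian process. -/
theorem IsComplexGaussianProcess.measure_lt_norm_le (hx : IsComplexGaussianProcess P x) {q : ℕ}
    (hq : 1 ≤ q) {Z : Lp ℂ 2 P} (hZ : Z ∈ gaussianSpan P x) {t A : ℝ} (ht : 0 < t) (hA : ‖Z‖ ≤ A) :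
    P {ω | t < ‖Z ω‖} ≤ ENNReal.ofReal (((gaussianMoment q).toReal * A / t) ^ q) := by
  have h0 : 0 ≤ A := (norm_nonneg _).trans hA
  have hq' : (1 : ℝ≥0∞) ≤ q := by exact_mod_cast hq
  have h1 := meas_ge_le_mul_pow_eLpNorm_enorm P (p := q) (by positivity) (ENNReal.natCast_ne_top q)
    (Lp.aestronglyMeasurable Z) (ε := ENNReal.ofReal t) (by simpa using ht) (by simp)
  have h2 := hx.eLpNorm_le hq' (ENNReal.natCast_ne_top q) hZ
  have h3 : ‖Z‖ₑ ≤ ENNReal.ofReal A := by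
    rw [← ofReal_norm]; exact ENNReal.ofReal_le_ofReal hA
  have h4 : {ω | t < ‖Z ω‖} ⊆ {ω | ENNReal.ofReal t ≤ ‖Z ω‖ₑ} := fun ω hω => by
    simp only [Set.mem_ofPred_eq] at hω ⊢
    rw [← ofReal_norm]; exact ENNReal.ofReal_le_ofReal hω.le
  refine (measure_mono h4).trans (h1.trans ?_)
  rw [ENNReal.toReal_natCast, ENNReal.rpow_natCast, ENNReal.rpow_natCast, ← mul_pow,
    ENNReal.ofReal_pow (by positivity)]
  gcongr
  rw [div_eq_inv_mul, ENNReal.ofReal_mul (by positivity), ENNReal.ofReal_mul (by positivity),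
    ENNReal.ofReal_toReal (gaussianMoment_ne_top (ENNReal.natCast_ne_top q)),
    ENNReal.ofReal_inv_of_pos ht]
  gcongr
  exact h2.trans (by gcongr)

/-! ### The innovation representation of a stationary Gaussian series -/

theorem inner_toL2 (hx : IsComplexGaussianProcess P x) (hs : IsStationary P x) (m n : ℤ) :
    inner ℂ (toL2 P (x m)) (toL2 P (x n)) = autocov P x (n - m) := by
  rw [L2.inner_def, ← hs m (n - m), add_sub_cancel]
  refine integral_congr_ae ?_
  filter_upwards [hx.coeFn_toL2 m, hx.coeFn_toL2 n] with ω h1 h2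
  rw [h1, h2]
  simp

theorem autocov_neg (hs : IsStationary P x) (u : ℤ) : autocov P x (-u) = star (autocov P x u) := by
  have h := hs u (-u)
  rw [add_neg_cancel] at h
  rw [← h, autocov, Complex.star_def, ← integral_conj]
  congr 1
  funext ω
  simp [mul_comm]

/-- The reversed spectral density as a continuous function on the circle. -/
theorem spectralDensity_eq (hr : Summable fun u => ‖autocov P x u‖) (ν : ℝ) :
    spectralDensity P x ν =
      (trigSeries (fun n => autocov P x (-n)) (ν : UnitAddCircle)).re := by
  have hr' : Summable fun n => ‖autocov P x (-n)‖ := (Equiv.neg ℤ).summable_iff.2 hr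
  have h := (Equiv.neg ℤ).hasSum_iff.2 (hasSum_trigSeries_apply hr' (ν : UnitAddCircle))
  rw [spectralDensity, ← h.tsum_eq]
  congr 1
  refine tsum_congr fun u => ?_
  simp only [Function.comp_apply, Equiv.neg_apply, neg_neg, fourier_coe_apply]
  congr 2
  push_cast
  ring

/-- A bound, uniform over the short memory series with spectral density at least `smin`, for the
causal coefficients. -/
theorem exists_causal_representation (C smin : ℝ) (hs : 0 < smin) : ∃ K : ℝ,
    ∀ {Ω : Type*} [MeasurableSpace Ω] {P : Measure Ω} {x : ℤ → Ω → ℂ},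
    IsComplexGaussianProcess P x → IsStationary P x →
    (Summable fun u : ℤ => (1 + |(u : ℝ)|) * ‖autocov P x u‖) →
    ∑' u : ℤ, (1 + |(u : ℝ)|) * ‖autocov P x u‖ ≤ C →
    (∀ ν ∈ Set.Icc (0 : ℝ) 1, smin ≤ spectralDensity P x ν) →
    (Summable fun k : ℕ => (1 + (k : ℝ)) * ‖causalCoeff P x k‖) ∧
    ∑' k : ℕ, (1 + (k : ℝ)) * ‖causalCoeff P x k‖ ≤ K ∧
    Orthonormal ℂ (innovation P x) ∧ (∀ n, innovation P x n ∈ gaussianSpan P x) ∧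
    ∀ n, HasSum (fun k : ℕ => causalCoeff P x k • innovation P x (n - k)) (toL2 P (x n)) := by
  obtain ⟨K, hK⟩ := exists_spectralFactor C smin hs
  refine ⟨K, fun {Ω _ P x} hx hst hsum hC hmin => ?_⟩
  -- The reflection matches `⟪Y m, Y n⟫ = r(n - m)` with the coefficient of index `m - n`.
  set c : ℤ → ℂ := fun n => autocov P x (-n) with hc
  have hr : Summable fun u => ‖autocov P x u‖ :=
    hsum.of_nonneg_of_le (fun _ => norm_nonneg _) fun u =>
      le_mul_of_one_le_left (norm_nonneg _) (by linarith [abs_nonneg (u : ℝ)])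
  have hcs' : Summable fun n => ‖c n‖ := (Equiv.neg ℤ).summable_iff.2 hr
  have hfun : (fun n : ℤ => (1 + |(n : ℝ)|) * ‖c n‖) =
      (fun u : ℤ => (1 + |(u : ℝ)|) * ‖autocov P x u‖) ∘ Equiv.neg ℤ := by
    funext n; simp [hc]
  have hcs : Summable fun n : ℤ => (1 + |(n : ℝ)|) * ‖c n‖ := by
    rw [hfun]; exact (Equiv.neg ℤ).summable_iff.2 hsum
  have hcC : ∑' n : ℤ, (1 + |(n : ℝ)|) * ‖c n‖ ≤ C := by
    rw [hfun]; exact ((Equiv.neg ℤ).tsum_eq _).trans_le hC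
  obtain ⟨H, G, hHG, hHK, h0, h0'⟩ := hK c hcs hcC (fun n => autocov_neg hst (-n)) (by
    intro z
    induction z using QuotientAddGroup.induction_on with
    | H ν =>
      have h1 : ((Int.fract ν : ℝ) : UnitAddCircle) = (ν : UnitAddCircle) := by
        rw [Int.fract, AddCircle.coe_sub]
        simp
      have h2 := hmin (Int.fract ν) ⟨Int.fract_nonneg _, (Int.fract_lt_one _).le⟩
      rw [spectralDensity_eq hr, h1] at h2
      exact h2)
  have hY : ∀ m n, inner ℂ (toL2 P (x m)) (toL2 P (x n)) = coeffCLM (m - n) (trigSeries c) :=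
    fun m n => by rw [inner_toL2 hx hst, coeffCLM_trigSeries hcs', hc]; simp
  obtain ⟨η, hη, hmem, hrep⟩ := exists_innovation hY hHG
  have hpe : ∀ n, predictionError P x n = coeffCLM 0 H • η n := fun n => by
    have := sub_starProjection_eq (a := fun k : ℕ => coeffCLM (-(k : ℤ)) H) hη hmem hrep n
      (past P x n) rfl
    simpa [predictionError] using this
  have hinn : innovation P x = η := by
    funext n
    have hn : ((‖coeffCLM 0 H‖ : ℝ) : ℂ) ≠ 0 := by simpa using h0'
    rw [innovation, hpe, norm_smul, hη.1, mul_one]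
    -- Positivity of the mean of `H` makes the normalized error equal to `η n` itself, without a
    -- phase.
    nth_rw 2 [h0]
    rw [smul_smul, Complex.ofReal_inv, inv_mul_cancel₀ hn, one_smul]
  have hcoef : ∀ k : ℕ, causalCoeff P x k = coeffCLM (-(k : ℤ)) H := fun k => by
    have h := (innerSL ℂ (η (-(k : ℤ)))).hasSum (hrep 0)
    simp only [map_smul, innerSL_apply_apply, smul_eq_mul, orthonormal_iff_ite.1 hη] at h
    rw [causalCoeff, hinn]
    refine h.unique (hasSum_of_forall_eq
      (hasSum_ite_eq k (coeffCLM (-(k : ℤ)) H)) fun j => ?_)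
    by_cases hjk : j = k
    · simp [hjk]
    · rw [if_neg hjk, if_neg (by omega), mul_zero]
  have hinj : Function.Injective fun k : ℕ => -(k : ℤ) := fun a b h => by simpa using h
  have hfun2 : (fun k : ℕ => (1 + (k : ℝ)) * ‖causalCoeff P x k‖) =
      (fun n : ℤ => (1 + |(n : ℝ)|) * ‖coeffCLM n H‖) ∘ fun k : ℕ => -(k : ℤ) := by
    funext k; simp [hcoef]
  refine ⟨?_, ?_, hinn ▸ hη, fun n => ?_, fun n => ?_⟩
  · rw [hfun2]; exact hHG.summable.comp_injective hinj
  · rw [hfun2]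
    exact (tsum_comp_le_tsum_of_inj hHG.summable (fun _ => by positivity) hinj).trans hHK
  · rw [hinn]
    exact Submodule.topologicalClosure_mono (Submodule.span_mono (Set.image_subset_range _ _))
      (hmem n)
  · simpa only [hinn, hcoef] using hrep n

theorem coeFn_vectorDft (N : ℕ) {v : ℤ → Lp ℂ 2 P} {w : ℤ → Ω → ℂ} (h : ∀ n, v n =ᵐ[P] w n)
    (ν : ℝ) : ⇑(vectorDft N v ν) =ᵐ[P] dft N w ν := by
  have h1 : ∀ᵐ ω ∂P, ∀ n ∈ Finset.Icc 1 N,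
      (Complex.exp (-2 * Real.pi * Complex.I * ((n : ℂ) - 1) * ν) • v (n : ℤ) : Lp ℂ 2 P) ω =
        w (n : ℤ) ω * Complex.exp (-2 * Real.pi * Complex.I * ((n : ℂ) - 1) * ν) := by
    rw [Finset.eventually_all]
    intro n _
    filter_upwards [Lp.coeFn_smul (Complex.exp (-2 * Real.pi * Complex.I * ((n : ℂ) - 1) * ν))
      (v n), h n] with ω h1 h2
    rw [h1, Pi.smul_apply, h2, smul_eq_mul, mul_comm]
  filter_upwards [h1, Lp.coeFn_smul (1 / (Real.sqrt N : ℂ)) (∑ n ∈ Finset.Icc 1 N,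
    Complex.exp (-2 * Real.pi * Complex.I * ((n : ℂ) - 1) * ν) • v (n : ℤ)),
    Lp.coeFn_finsetSum (Finset.Icc 1 N) fun n : ℕ =>
      Complex.exp (-2 * Real.pi * Complex.I * ((n : ℂ) - 1) * ν) • v (n : ℤ)] with ω h1 h2 h3
  rw [vectorDft, h2, Pi.smul_apply, h3, Finset.sum_apply, dft, smul_eq_mul]
  congr 1
  exact Finset.sum_congr rfl h1

theorem vectorDft_mem {E : Type*} [NormedAddCommGroup E] [InnerProductSpace ℂ E] (N : ℕ)
    {v : ℤ → E} {U : Submodule ℂ E} (h : ∀ n, v n ∈ U) (ν : ℝ) : vectorDft N v ν ∈ U :=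
  U.smul_mem _ (U.sum_mem fun n _ => U.smul_mem _ (h n))

end BartlettApprox

namespace BartlettApprox

variable {Ω : Type*} [MeasurableSpace Ω] {P : Measure Ω} {x z : ℤ → Ω → ℂ}

/-! ### Deviation of the smoothed periodograms -/

/-- The filtered Fourier transform `h ξ_ε` of the innovations. -/
noncomputable def filteredDft (P : Measure Ω) (N : ℕ) (x : ℤ → Ω → ℂ) (ν : ℝ) (ω : Ω) : ℂ :=
  transfer P x ν * dft N (fun n => ⇑(innovation P x n)) ν ω

/-- The event that the Fourier transform of `x` at `ν`, or that of its innovations, is large, or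
that their difference is. -/
def exceptionalSet (P : Measure Ω) (N : ℕ) (x : ℤ → Ω → ℂ) (u ν : ℝ) : Set Ω :=
  {ω | u / Real.sqrt N < ‖dft N x ν ω - filteredDft P N x ν ω‖} ∪
    ({ω | u < ‖dft N x ν ω‖} ∪ {ω | u < ‖filteredDft P N x ν ω‖})

/-- The `L²` norms of `ξ_x - h ξ_ε`, `h ξ_ε` and `ξ_x` are at most `2K/√N`, `K` and `3K`. Relative
to its threshold, each is at most `3K/u`, whence three equal tail bounds. -/
theorem measure_exceptionalSet_le (hx : IsComplexGaussianProcess P x) {K : ℝ}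
    (hsum : Summable fun k : ℕ => (1 + (k : ℝ)) * ‖causalCoeff P x k‖)
    (hK : ∑' k : ℕ, (1 + (k : ℝ)) * ‖causalCoeff P x k‖ ≤ K)
    (hon : Orthonormal ℂ (innovation P x)) (hmem : ∀ n, innovation P x n ∈ gaussianSpan P x)
    (hrep : ∀ n, HasSum (fun k : ℕ => causalCoeff P x k • innovation P x (n - k)) (toL2 P (x n)))
    {q : ℕ} (hq : 1 ≤ q) {N : ℕ} (hN : 1 ≤ N) {u : ℝ} (hu : 0 < u) (ν : ℝ) :
    P (exceptionalSet P N x u ν) ≤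
      3 * ENNReal.ofReal (((gaussianMoment q).toReal * (3 * K) / u) ^ q) := by
  have hN1 : 1 ≤ Real.sqrt N := Real.one_le_sqrt.2 (by exact_mod_cast hN)
  have hK0 : 0 ≤ K := (tsum_nonneg fun k => by positivity).trans hK
  set Y : ℤ → Lp ℂ 2 P := fun n => toL2 P (x n)
  set X := vectorDft N Y ν
  set F := transfer P x ν • vectorDft N (innovation P x) ν
  have hle : ∀ k : ℕ, ‖causalCoeff P x k‖ ≤ (1 + (k : ℝ)) * ‖causalCoeff P x k‖ := fun k =>
    le_mul_of_one_le_left (norm_nonneg _) (by linarith [k.cast_nonneg (α := ℝ)])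
  have hsum' : Summable fun k => ‖causalCoeff P x k‖ :=
    hsum.of_nonneg_of_le (fun _ => norm_nonneg _) hle
  have htr : ‖transfer P x ν‖ ≤ K := by
    have h1 : ∀ k : ℕ, ‖causalCoeff P x k * Complex.exp (-2 * Real.pi * Complex.I * k * ν)‖ =
        ‖causalCoeff P x k‖ := fun k => by
      have h2 : ‖Complex.exp (-2 * Real.pi * Complex.I * k * ν)‖ = 1 := norm_exp_eq_one k ν
      rw [norm_mul, h2, mul_one]
    refine (norm_tsum_le_tsum_norm (by simpa only [h1] using hsum')).trans ?_
    simp only [h1]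
    exact (hsum'.tsum_le_tsum hle hsum).trans hK
  have hF : ‖F‖ ≤ K := by
    rw [norm_smul]
    exact (mul_le_of_le_one_right (norm_nonneg _) (norm_vectorDft_le_one N hon ν)).trans htr
  have hD : ‖X - F‖ ≤ 2 / Real.sqrt N * K :=
    (norm_vectorDft_sub_le hon.1 hrep hsum N ν).trans (by gcongr)
  have hD' : 2 / Real.sqrt N * K ≤ 2 * K := by
    gcongr; exact div_le_self zero_le_two hN1
  have hX : ‖X‖ ≤ 3 * K := by
    have := norm_add_le (X - F) F
    rw [sub_add_cancel] at this
    linarith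
  have hYm : ∀ n, Y n ∈ gaussianSpan P x := fun n =>
    Submodule.le_topologicalClosure _ (Submodule.subset_span ⟨n, rfl⟩)
  have hXm : X ∈ gaussianSpan P x := vectorDft_mem N hYm ν
  have hFm : F ∈ gaussianSpan P x := Submodule.smul_mem _ _ (vectorDft_mem N hmem ν)
  have hXae : ⇑X =ᵐ[P] dft N x ν := coeFn_vectorDft N hx.coeFn_toL2 ν
  have hFae : ⇑F =ᵐ[P] filteredDft P N x ν := by
    filter_upwards [Lp.coeFn_smul (transfer P x ν) (vectorDft N (innovation P x) ν),
      coeFn_vectorDft N (fun n => ae_eq_refl (innovation P x n)) ν] with ω h1 h2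
    rw [h1, Pi.smul_apply, h2, smul_eq_mul]
    rfl
  have hDae : ⇑(X - F) =ᵐ[P] fun ω => dft N x ν ω - filteredDft P N x ν ω := by
    filter_upwards [Lp.coeFn_sub X F, hXae, hFae] with ω h1 h2 h3
    rw [h1, Pi.sub_apply, h2, h3]
  have key : ∀ {Z : Lp ℂ 2 P} {f : Ω → ℂ} {t A : ℝ}, Z ∈ gaussianSpan P x → ⇑Z =ᵐ[P] f → 0 < t →
      ‖Z‖ ≤ A → A / t ≤ 3 * K / u → P {ω | t < ‖f ω‖} ≤
        ENNReal.ofReal (((gaussianMoment q).toReal * (3 * K) / u) ^ q) := by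
    intro Z f t A hZ hf ht hA hAt
    have h1 : P {ω | t < ‖f ω‖} = P {ω | t < ‖Z ω‖} := by
      refine measure_congr ?_
      filter_upwards [hf] with ω h
      change (t < ‖f ω‖) = (t < ‖Z ω‖)
      rw [h]
    have h0 : 0 ≤ A := (norm_nonneg _).trans hA
    rw [h1]
    refine (hx.measure_lt_norm_le hq hZ ht hA).trans (ENNReal.ofReal_le_ofReal ?_)
    rw [mul_div_assoc, mul_div_assoc]
    gcongr
  have e1 := key (Submodule.sub_mem _ hXm hFm) hDae (t := u / Real.sqrt N) (by positivity) hD (by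
    rw [show 2 / Real.sqrt N * K / (u / Real.sqrt N) = 2 * K / u by field_simp]
    gcongr; norm_num)
  have e2 := key hXm hXae hu hX le_rfl
  have e3 := key hFm hFae hu hF (by gcongr; linarith)
  refine (measure_union_le _ _).trans ((add_le_add e1 ((measure_union_le _ _).trans
    (add_le_add e2 e3))).trans_eq ?_)
  ring

/-- Each summand is a difference of products, written as (error) × (bounded) + (bounded) × (error)
with errors at most `u/√N` and factors at most `u`. -/
theorem norm_sHat_sub_sTilde_le {N B : ℕ} {u ν : ℝ} {ω : Ω} (hu : 0 ≤ u)
    (hx : ∀ b ∈ Finset.Icc (-((B : ℤ) / 2)) ((B : ℤ) / 2), ω ∉ exceptionalSet P N x u (ν + b / N))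
    (hz : ∀ b ∈ Finset.Icc (-((B : ℤ) / 2)) ((B : ℤ) / 2), ω ∉ exceptionalSet P N z u (ν + b / N)) :
    ‖sHat N B x z ν ω - sTilde P N B x z ν ω‖ ≤ 2 * u ^ 2 / Real.sqrt N := by
  have hterm : ∀ b ∈ Finset.Icc (-((B : ℤ) / 2)) ((B : ℤ) / 2),
      ‖dft N x (ν + b / N) ω * star (dft N z (ν + b / N) ω) -
        transfer P x (ν + b / N) * star (transfer P z (ν + b / N)) *
          dft N (fun n => ⇑(innovation P x n)) (ν + b / N) ω *
          star (dft N (fun n => ⇑(innovation P z n)) (ν + b / N) ω)‖ ≤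
      2 * u ^ 2 / Real.sqrt N := by
    intro b hb
    have h1 := hx b hb
    have h2 := hz b hb
    simp only [exceptionalSet, Set.mem_union, Set.mem_ofPred_eq, not_or, not_lt] at h1 h2
    set μ := ν + b / N
    have h3 : dft N x μ ω * star (dft N z μ ω) - transfer P x μ * star (transfer P z μ) *
          dft N (fun n => ⇑(innovation P x n)) μ ω * star (dft N (fun n => ⇑(innovation P z n)) μ ω) =
        (dft N x μ ω - filteredDft P N x μ ω) * star (dft N z μ ω) +
          filteredDft P N x μ ω * star (dft N z μ ω - filteredDft P N z μ ω) := by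
      simp only [filteredDft, star_sub, star_mul']
      ring
    rw [h3]
    refine (norm_add_le _ _).trans ?_
    rw [norm_mul, norm_mul, norm_star, norm_star]
    calc _ ≤ u / Real.sqrt N * u + u * (u / Real.sqrt N) := by
          gcongr
          exacts [h1.1, h2.2.1, h1.2.2, h2.1]
      _ = _ := by ring
  have hcard : ((Finset.Icc (-((B : ℤ) / 2)) ((B : ℤ) / 2)).card : ℝ) ≤ B + 1 := by
    rw [Int.card_Icc]
    have : ((B : ℤ) / 2 + 1 - -((B : ℤ) / 2)).toNat ≤ B + 1 := by omega
    exact_mod_cast this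
  rw [sHat, sTilde, ← mul_sub, ← Finset.sum_sub_distrib, norm_mul]
  have h1 : ‖(1 / ((B : ℂ) + 1))‖ = 1 / ((B : ℝ) + 1) := by
    rw [norm_div, norm_one]
    congr 1
    exact_mod_cast Complex.norm_natCast (B + 1)
  have h2 := (norm_sum_le _ _).trans (Finset.sum_le_sum hterm)
  rw [Finset.sum_const, nsmul_eq_mul] at h2
  have h0 : 0 ≤ 2 * u ^ 2 / Real.sqrt N := by positivity
  rw [h1]
  calc _ ≤ 1 / ((B : ℝ) + 1) * ((B + 1) * (2 * u ^ 2 / Real.sqrt N)) := by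
        gcongr
        exact h2.trans (by gcongr)
    _ = _ := by field_simp

/-- The frequencies used by the smoothed periodograms on the grid. -/
noncomputable def shiftedGrid (N B : ℕ) : Finset ℝ :=
  (freqGrid N B ×ˢ Finset.Icc (-((B : ℤ) / 2)) ((B : ℤ) / 2)).image fun p => p.1 + p.2 / N

theorem card_shiftedGrid_le (N B : ℕ) : (shiftedGrid N B).card ≤ (N + 1) * (B + 1) := by
  refine Finset.card_image_le.trans ?_
  rw [Finset.card_product]
  refine Nat.mul_le_mul ?_ ?_
  · refine Finset.card_image_le.trans ?_
    rw [Finset.card_range]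
    exact Nat.add_le_add_right (Nat.div_le_self _ _) 1
  · rw [Int.card_Icc]; omega

theorem maxDeviation_le {y : ℕ → ℤ → Ω → ℂ} {N M B : ℕ} {u : ℝ} {ω : Ω} (hu : 0 ≤ u)
    (h : ∀ p ∈ Finset.range M ×ˢ shiftedGrid N B, ω ∉ exceptionalSet P N (y p.1) u p.2) :
    maxDeviation P y N M B ω ≤ 2 * u ^ 2 / Real.sqrt N := by
  have h0 : 0 ≤ 2 * u ^ 2 / Real.sqrt N := by positivity
  rw [maxDeviation, ← Real.coe_toNNReal _ h0, NNReal.coe_le_coe, Finset.sup_le_iff]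
  rintro ⟨i, j, ν⟩ hp
  simp only [indexSet, Finset.mem_filter, Finset.mem_product] at hp
  rw [← NNReal.coe_le_coe, Real.coe_toNNReal _ h0, coe_nnnorm]
  have hmem : ∀ b ∈ Finset.Icc (-((B : ℤ) / 2)) ((B : ℤ) / 2), ν + b / N ∈ shiftedGrid N B :=
    fun b hb => Finset.mem_image.2 ⟨(ν, b), Finset.mem_product.2 ⟨hp.1.2.2, hb⟩, rfl⟩
  exact norm_sHat_sub_sTilde_le hu
    (fun b hb => h (i, ν + b / N) (Finset.mem_product.2 ⟨hp.1.1, hmem b hb⟩))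
    (fun b hb => h (j, ν + b / N) (Finset.mem_product.2 ⟨hp.1.2.1, hmem b hb⟩))

theorem maxDeviation_nonneg (P : Measure Ω) (y : ℕ → ℤ → Ω → ℂ) (N M B : ℕ) (ω : Ω) :
    0 ≤ maxDeviation P y N M B ω := NNReal.coe_nonneg _

/-- Union bound for the probability that the maximal deviation is large. -/
theorem measure_maxDeviation_le {y : ℕ → ℤ → Ω → ℂ} {N M B : ℕ} {u β : ℝ} (hu : 0 ≤ u)
    (hβ : ∀ m ν, P (exceptionalSet P N (y m) u ν) ≤ ENNReal.ofReal β) :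
    P {ω | 2 * u ^ 2 / Real.sqrt N < maxDeviation P y N M B ω} ≤
      ENNReal.ofReal (M * ((N + 1) * (B + 1)) * β) := by
  have hsub : {ω | 2 * u ^ 2 / Real.sqrt N < maxDeviation P y N M B ω} ⊆
      ⋃ p ∈ Finset.range M ×ˢ shiftedGrid N B, exceptionalSet P N (y p.1) u p.2 := by
    intro ω hω
    by_contra hn
    simp only [Set.mem_iUnion, not_exists] at hn
    exact absurd (maxDeviation_le hu hn) (not_le.2 hω)
  refine (measure_mono hsub).trans ((measure_biUnion_finset_le _ _).trans ?_)
  refine (Finset.sum_le_sum fun p _ => hβ p.1 p.2).trans ?_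
  rw [Finset.sum_const, nsmul_eq_mul, Finset.card_product, Finset.card_range,
    ENNReal.ofReal_mul (by positivity)]
  gcongr
  rw [← ENNReal.ofReal_natCast]
  refine ENNReal.ofReal_le_ofReal ?_
  have := Nat.mul_le_mul_left M (card_shiftedGrid_le N B)
  exact_mod_cast this

end BartlettApprox

/-! ### Choice of the exponents and conclusion. -/

theorem proposition4 {Ω : Type*} [MeasurableSpace Ω] (P : Measure Ω) [IsProbabilityMeasure P]
    (y : ℕ → ℤ → Ω → ℂ)
    (hmeas : ∀ m n, Measurable (y m n))
    (hindep : iIndepFun (fun (m : ℕ) (ω : Ω) (n : ℤ) => y m n ω) P)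
    (hstat : ∀ m, BartlettApprox.IsStationary P (y m))
    (hgauss : ∀ m, BartlettApprox.IsComplexGaussianProcess P (y m))
    (hmem : BartlettApprox.UniformShortMemory P y)
    (hspec : BartlettApprox.NonVanishingSpectrum P y)
    (M B : ℕ → ℕ) (hB : ∀ N, Even (B N))
    (ρ C₁ C₂ c : ℝ) (hρ : ρ ∈ Set.Ioo (0 : ℝ) 1) (hC₁ : 0 < C₁) (hC₂ : 0 < C₂) (hc : 0 < c)
    (hBrate : ∀ᶠ N : ℕ in atTop, C₁ * (N : ℝ) ^ ρ ≤ B N ∧ (B N : ℝ) ≤ C₂ * (N : ℝ) ^ ρ)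
    (hMrate : ∀ᶠ N : ℕ in atTop, C₁ * (N : ℝ) ^ ρ ≤ M N ∧ (M N : ℝ) ≤ C₂ * (N : ℝ) ^ ρ)
    (hratio : Tendsto (fun N : ℕ => (M N : ℝ) / (B N : ℝ)) atTop (𝓝 c)) :
    (∀ m, Summable (fun k : ℕ => ‖BartlettApprox.causalCoeff P (y m) k‖)) ∧
    ∃ δ : ℝ, 0 < δ ∧
      BartlettApprox.IsBigOInProb P
        (fun N ω => Real.sqrt ((B N : ℝ) + 1) *
          BartlettApprox.maxDeviation P y N (M N) (B N) ω)
        (fun N => (N : ℝ) ^ (-δ)) := by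
  obtain ⟨C, hC⟩ := hmem
  obtain ⟨smin, hsmin, hlow⟩ := hspec
  obtain ⟨K, hK⟩ := BartlettApprox.exists_causal_representation C smin hsmin
  have hrep := fun m => hK (hgauss m) (hstat m) (hC m).1 (hC m).2 (hlow m)
  refine ⟨fun m => (hrep m).1.of_nonneg_of_le (fun _ => norm_nonneg _) fun k =>
    le_mul_of_one_le_left (norm_nonneg _) (by linarith [k.cast_nonneg (α := ℝ)]), ?_⟩
  obtain ⟨hρ0, hρ1⟩ := hρ
  -- With this `ε`, the final exponent `ρ/2 + 2ε - 1/2` equals `-(1 - ρ)/4`.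
  set ε := (1 - ρ) / 8 with hε
  have hε0 : 0 < ε := by rw [hε]; linarith
  refine ⟨(1 - ρ) / 4, by linarith, fun η hη => ⟨2 * Real.sqrt (C₂ + 1), by positivity, ?_⟩⟩
  -- Each exceptional set then has probability `O(N^{-4})`, which beats the `O(N³)` sets in the
  -- union bound.
  obtain ⟨q, hq⟩ := exists_nat_ge (4 / ε)
  have hqε : 4 ≤ ε * q := by rwa [div_le_iff₀' hε0] at hq
  have hq1 : 1 ≤ q := by
    rcases Nat.eq_zero_or_pos q with rfl | h
    · norm_num at hqε
    · exact h
  set A := (BartlettApprox.gaussianMoment q).toReal * (3 * K) with hA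
  have hK0 : 0 ≤ K := (tsum_nonneg fun k => by positivity).trans (hrep 0).2.1
  have hA0 : 0 ≤ A := by positivity
  have hlim : Tendsto (fun N : ℕ => C₂ * (2 * (C₂ + 1)) * (3 * A ^ q) * ((N : ℝ))⁻¹) atTop (𝓝 0) := by
    simpa using (tendsto_inv_atTop_nhds_zero_nat (𝕜 := ℝ)).const_mul
      (C₂ * (2 * (C₂ + 1)) * (3 * A ^ q))
  filter_upwards [hBrate, hMrate, eventually_ge_atTop 1, hlim.eventually_le_const hη]
    with N hBN hMN hN hηN
  have hN1 : (1 : ℝ) ≤ N := by exact_mod_cast hN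
  have hN0 : (0 : ℝ) < N := by linarith
  have hNρ : (N : ℝ) ^ ρ ≤ N := by
    simpa using Real.rpow_le_rpow_of_exponent_le hN1 hρ1.le
  have hNρ1 : 1 ≤ (N : ℝ) ^ ρ := Real.one_le_rpow hN1 hρ0.le
  have hu : 0 < (N : ℝ) ^ ε := by positivity
  have hBN' : (B N : ℝ) + 1 ≤ (C₂ + 1) * (N : ℝ) ^ ρ := by nlinarith [hBN.2]
  have hβ : ∀ m ν, P (BartlettApprox.exceptionalSet P N (y m) ((N : ℝ) ^ ε) ν) ≤
      ENNReal.ofReal (3 * A ^ q * ((N : ℝ) ^ 4)⁻¹) := by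
    intro m ν
    obtain ⟨h1, h2, h3, h4, h5⟩ := hrep m
    refine (BartlettApprox.measure_exceptionalSet_le (hgauss m) h1 h2 h3 h4 h5 hq1 hN hu ν).trans ?_
    rw [show (3 : ℝ≥0∞) = ENNReal.ofReal 3 by simp, ← ENNReal.ofReal_mul (by norm_num)]
    refine ENNReal.ofReal_le_ofReal ?_
    rw [mul_assoc, ← hA, div_pow, div_eq_mul_inv]
    gcongr
    rw [← Real.rpow_natCast ((N : ℝ) ^ ε), ← Real.rpow_mul hN0.le, ← Real.rpow_natCast]
    exact Real.rpow_le_rpow_of_exponent_le hN1 (by exact_mod_cast hqε)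
  have hsub : {ω | 2 * Real.sqrt (C₂ + 1) * (N : ℝ) ^ (-((1 - ρ) / 4)) <
      |Real.sqrt ((B N : ℝ) + 1) * BartlettApprox.maxDeviation P y N (M N) (B N) ω|} ⊆
      {ω | 2 * ((N : ℝ) ^ ε) ^ 2 / Real.sqrt N <
        BartlettApprox.maxDeviation P y N (M N) (B N) ω} := by
    intro ω hω
    simp only [Set.mem_ofPred_eq] at hω ⊢
    by_contra hn
    rw [not_lt] at hn
    refine absurd hω (not_lt.2 ?_)
    have hd := BartlettApprox.maxDeviation_nonneg P y N (M N) (B N) ω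
    rw [abs_of_nonneg (by positivity)]
    calc _ ≤ Real.sqrt ((C₂ + 1) * (N : ℝ) ^ ρ) * (2 * ((N : ℝ) ^ ε) ^ 2 / Real.sqrt N) := by
          gcongr
      _ = 2 * Real.sqrt (C₂ + 1) * ((N : ℝ) ^ (ρ / 2) * (N : ℝ) ^ (ε * 2) * (N : ℝ) ^ (-(1 / 2) : ℝ)) := by
          rw [Real.sqrt_mul (by positivity), Real.sqrt_eq_rpow ((N : ℝ) ^ ρ), ← Real.rpow_mul hN0.le,
            Real.sqrt_eq_rpow (N : ℝ), Real.rpow_neg hN0.le, Real.rpow_mul hN0.le ε,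
            Real.rpow_two]
          ring_nf
      _ = 2 * Real.sqrt (C₂ + 1) * (N : ℝ) ^ (-((1 - ρ) / 4)) := by
          rw [← Real.rpow_add hN0, ← Real.rpow_add hN0]
          congr 2
          rw [hε]; ring
      _ ≤ _ := le_rfl
  refine (measure_mono hsub).trans ((BartlettApprox.measure_maxDeviation_le hu.le hβ).trans
    (ENNReal.ofReal_le_ofReal (le_trans ?_ hηN)))
  calc (M N : ℝ) * ((N + 1) * (B N + 1)) * (3 * A ^ q * ((N : ℝ) ^ 4)⁻¹)
      ≤ (C₂ * N) * ((2 * N) * ((C₂ + 1) * N)) * (3 * A ^ q * ((N : ℝ) ^ 4)⁻¹) := by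
        gcongr
        · exact hMN.2.trans (by gcongr)
        · linarith
        · exact hBN'.trans (by gcongr)
    _ = C₂ * (2 * (C₂ + 1)) * (3 * A ^ q) * ((N : ℝ))⁻¹ := by field_simp
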